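/- Let $n\in\mathbb N$, let $Y=\{y_1<\dots<y_n\}\subset\mathbb R$ be a set of $n$ points, and let $\sigma_1=\begin{bmatrix}0&1\\1&0\end{bmatrix}$, $\sigma_3=\begin{bmatrix}1&0\\0&-1\end{bmatrix}$. Let $\mathsf D:=-i\frac{d}{dx}\sigma_1+\frac12\sigma_3$ with domain $H^1(\mathbb R;\mathbb C^2)$ in $L^2(\mathbb R;\mathbb C^2)$, and $\mathsf H:=-\frac{d^2}{dx^2}$ with domain $H^2(\mathbb R)$ in $L^2(\mathbb R)$. For $k=1,2$, $H^k(\mathbb R\setminus Y;\cdot)$ denotes the space of $L^2$ functions on $\mathbb R$ whose distributional derivatives on $\mathbb R\setminus Y$ up to order $k$ are in $L^2$; for $f\in H^1(\mathbb R\setminus Y;\cdot)$ put $\langle f\rangle_y:=\frac12(f(y^-)+f(y^+))$. Define $$\tau:H^1(\mathbb R\setminus Y;\mathbb C^2)\to\mathbb C^{2n},\quad \tau\Psi:=(\langle\Psi\rangle_{y_1},\dots,\langle\Psi\rangle_{y_n}),$$ $$\widehat\tau:H^2(\mathbb R\setminus Y)\to\mathbb C^{2n},\quad \widehat\tau\psi:=(\langle\psi\rangle_{y_1}\oplus\langle\psi'\rangle_{y_1},\dots,\langle\psi\rangle_{y_n}\oplus\langle\psi'\rangle_{y_n}),$$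 where $\psi'$ is the distributional derivative on $\mathbb R\setminus Y$, and let $S:=\mathsf D|\ker(\tau|H^1(\mathbb R;\mathbb C^2))$ and $\widehat S:=\mathsf H|\ker(\widehat\tau|H^2(\mathbb R))$. Let $\varrho(\cdot)$ denote the resolvent set, and put $$G_z:=(\tau(-\mathsf D+\bar z)^{-1})^*:\mathbb C^{2n}\to L^2(\mathbb R;\mathbb C^2),\quad z\in\varrho(\mathsf D),\qquad \widehat G_z:=(\widehat\tau(-\mathsf H+\bar z)^{-1})^*:\mathbb C^{2n}\to L^2(\mathbb R),\quad z\in\varrho(\mathsf H).$$ For an orthogonal projector $\Pi$ on $\mathbb C^{2n}$, the same symbol denotes the surjection $\mathbb C^{2n}\to\operatorname{ran}(\Pi)$ and the injection $\operatorname{ran}(\Pi)\to\mathbb C^{2n}$. **Theorem.** The operators $G_z$ and $\widehat G_z$ are well defined and bounded, $\operatorname{ran}G_z\subseteq H^1(\mathbb R\setminus Y;\mathbb C^2)$ and $\operatorname{ran}\widehat G_z\subseteq H^2(\mathbb R\setminus Y)$, so that $\tau G_z$ and $\widehat\tau\widehat G_z$ are well defined linear operators on $\mathbb C^{2n}$.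 Moreover, there are bijections $(\Pi,\Theta)\mapsto\mathsf D_{\Pi,\Theta}$ and $(\Pi,\Theta)\mapsto\mathsf H_{\Pi,\Theta}$ from the set of all couples $(\Pi,\Theta)$, $\Pi:\mathbb C^{2n}\to\mathbb C^{2n}$ an orthogonal projector and $\Theta:\operatorname{ran}(\Pi)\to\operatorname{ran}(\Pi)$ symmetric, onto the set of all self-adjoint extensions of $S$ and onto the set of all self-adjoint extensions of $\widehat S$, respectively, such that for every $(\Pi,\Theta)$ the following holds. 1. For all $z\in\varrho(\mathsf D_{\Pi,\Theta})\cap\varrho(\mathsf D)$ the operator $\Theta-\Pi\,\tau G_z\Pi$ is invertible on $\operatorname{ran}(\Pi)$ and $$(-\mathsf D_{\Pi,\Theta}+z)^{-1}=(-\mathsf D+z)^{-1}+G_z\Pi(\Theta-\Pi\,\tau G_z\Pi)^{-1}\Pi G_{\bar z}^*;$$ for all $z\in\varrho(\mathsf H_{\Pi,\Theta})\cap\varrho(\mathsf H)$ the operator $\Theta-\Pi\,\widehat\tau\widehat G_z\Pi$ is invertible on $\operatorname{ran}(\Pi)$ and $$(-\mathsf H_{\Pi,\Theta}+z)^{-1}=(-\mathsf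 H+z)^{-1}+\widehat G_z\Pi(\Theta-\Pi\,\widehat\tau\widehat G_z\Pi)^{-1}\Pi\widehat G_{\bar z}^*.$$ 2. For every $z\in\varrho(\mathsf D)$, respectively every $z\in\varrho(\mathsf H)$, $$\operatorname{dom}(\mathsf D_{\Pi,\Theta})=\{\Psi\in L^2(\mathbb R;\mathbb C^2):\Psi=\Psi_z+G_z\xi,\ \Psi_z\in H^1(\mathbb R;\mathbb C^2),\ \xi\in\operatorname{ran}(\Pi),\ \Pi\tau\Psi=\Theta\xi\},\quad(-\mathsf D_{\Pi,\Theta}+z)\Psi=(-\mathsf D+z)\Psi_z,$$ $$\operatorname{dom}(\mathsf H_{\Pi,\Theta})=\{\psi\in L^2(\mathbb R):\psi=\psi_z+\widehat G_z\xi,\ \psi_z\in H^2(\mathbb R),\ \xi\in\operatorname{ran}(\Pi),\ \Pi\widehat\tau\psi=\Theta\xi\},\quad(-\mathsf H_{\Pi,\Theta}+z)\psi=(-\mathsf H+z)\psi_z.$$ 3. For every $z$, the decompositions $\Psi=\Psi_z+G_z\xi$ of $\Psi\in\operatorname{dom}(\mathsf D_{\Pi,\Theta})$ and $\psi=\psi_z+\widehat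 G_z\xi$ of $\psi\in\operatorname{dom}(\mathsf H_{\Pi,\Theta})$ (with $\Psi_z\in H^1(\mathbb R;\mathbb C^2)$, respectively $\psi_z\in H^2(\mathbb R)$, and $\xi\in\operatorname{ran}(\Pi)$) are unique, and $\xi$ does not depend on $z$. -/

import Mathlib

open MeasureTheory Filter Topology
open scoped ContDiff

namespace PointInteraction
noncomputable section

/-- `L²(ℝ; V)`. -/
abbrev L2 (V : Type*) [NormedAddCommGroup V] := Lp V 2 (volume : Measure ℝ)

/-- `g` is the distributional derivative of `f` on the open set `ℝ ∖ Y`. For `f`, `g` with values in a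
complex space it makes no difference whether the test functions are real or complex valued. -/
def HasWeakDeriv {V : Type*} [NormedAddCommGroup V] [NormedSpace ℂ V] (Y : Finset ℝ)
    (f g : L2 V) : Prop :=
  ∀ φ : ℝ → ℝ, ContDiff ℝ ∞ φ → HasCompactSupport φ → Disjoint (tsupport φ) (Y : Set ℝ) →
    ∫ x, deriv φ x • f x = - ∫ x, φ x • g x

theorem locallyIntegrable_L2 {V : Type*} [NormedAddCommGroup V] (f : L2 V) :
    LocallyIntegrable f volume :=
  (Lp.memLp f).locallyIntegrable (by norm_num)

theorem integrable_test_smul {V : Type*} [NormedAddCommGroup V] [NormedSpace ℝ V]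
    {φ : ℝ → ℝ} (hφ : Continuous φ) (hc : HasCompactSupport φ)
    {f : ℝ → V} (hf : LocallyIntegrable f volume) : Integrable (fun x => φ x • f x) :=
  hf.integrable_smul_left_of_hasCompactSupport hφ hc

theorem HasWeakDeriv.unique {V : Type*} [NormedAddCommGroup V] [NormedSpace ℂ V]
    [CompleteSpace V] {Y : Finset ℝ} {f g g' : L2 V}
    (h : HasWeakDeriv Y f g) (h' : HasWeakDeriv Y f g') : g = g' := by
  have hU : IsOpen ((Y : Set ℝ)ᶜ) := Y.finite_toSet.isClosed.isOpen_compl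
  have key := hU.ae_eq_zero_of_integral_contDiff_smul_eq_zero (μ := volume)
    (f := fun x => g x - g' x)
    (((locallyIntegrable_L2 g).sub (locallyIntegrable_L2 g')).locallyIntegrableOn _) (by
      intro φ hφ hc hs
      have hd := Set.disjoint_left.2 fun x hx hy => hs hx hy
      have i1 := integrable_test_smul hφ.continuous hc (locallyIntegrable_L2 g)
      have i2 := integrable_test_smul hφ.continuous hc (locallyIntegrable_L2 g')
      simp only [smul_sub]
      rw [integral_sub i1 i2, sub_eq_zero]
      have := (h φ hφ hc hd).symm.trans (h' φ hφ hc hd)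
      exact neg_injective this)
  have hn : ∀ᵐ x ∂(volume : Measure ℝ), x ∈ ((Y : Set ℝ)ᶜ) :=
    measure_eq_zero_iff_ae_notMem.1 (Y.finite_toSet.measure_zero volume)
  refine Lp.ext ?_
  filter_upwards [key, hn] with x h1 h2 using sub_eq_zero.1 (h1 h2)

/-- Integration by parts of a test function against a primitive. -/
theorem integral_deriv_smul_primitive {V : Type*} [NormedAddCommGroup V] [NormedSpace ℝ V]
    [CompleteSpace V] {a b : ℝ} {χ : ℝ → ℝ} (hχ : ContDiff ℝ 1 χ)
    (hs : tsupport χ ⊆ Set.Ioo a b) {g : ℝ → V} (hg : LocallyIntegrable g volume) :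
    ∫ x, deriv χ x • (∫ t in a..x, g t) = - ∫ x, χ x • g x := by
  have hg1 : IntegrableOn g (Set.Ioc a b) volume :=
    (hg.integrableOn_isCompact isCompact_Icc).mono_set Set.Ioc_subset_Icc_self
  have hd0 : ∀ x, x ∉ Set.Ioo a b → deriv χ x = 0 := fun x hx =>
    image_eq_zero_of_notMem_tsupport fun h => hx (hs (tsupport_deriv_subset  h))
  have h0 : ∀ x, x ∉ Set.Ioo a b → χ x = 0 := fun x hx =>
    image_eq_zero_of_notMem_tsupport fun h => hx (hs h)
  have hdc : Continuous (deriv χ) := hχ.continuous_deriv le_rfl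
  have hcs : HasCompactSupport χ := by
    refine HasCompactSupport.intro isCompact_Icc (K := Set.Icc a b) fun x hx => h0 x ?_
    exact fun h => hx (Set.Ioo_subset_Icc_self h)
  have hdi : Integrable (deriv χ) := hdc.integrable_of_hasCompactSupport hcs.deriv
  -- write both sides as double integrals
  have hL : ∀ x, deriv χ x • (∫ t in a..x, g t)
      = ∫ t, (if t ≤ x then deriv χ x else 0) • (Set.Ioc a b).indicator g t := by
    intro x
    by_cases hx : x ∈ Set.Ioo a b
    · rw [intervalIntegral.integral_of_le hx.1.le, ← integral_smul,
        ← integral_indicator measurableSet_Ioc]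
      congr 1
      ext t
      by_cases ht : t ∈ Set.Ioc a x
      · have : t ∈ Set.Ioc a b := ⟨ht.1, ht.2.trans hx.2.le⟩
        simp [ht, this, ht.2]
      · rw [Set.indicator_of_notMem ht]
        by_cases h1 : t ≤ x
        · have : t ∉ Set.Ioc a b := fun h => ht ⟨h.1, h1⟩
          simp [this]
        · simp [h1]
    · simp [hd0 x hx]
  have hR : ∀ t, (∫ x, (if t ≤ x then deriv χ x else 0) • (Set.Ioc a b).indicator g t)
      = - (χ t • g t) := by
    intro t
    by_cases ht : t ∈ Set.Ioc a b
    · rw [integral_smul_const]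
      have : ∫ x, (if t ≤ x then deriv χ x else 0) = - χ t := by
        have e : (fun x => if t ≤ x then deriv χ x else 0) = (Set.Ici t).indicator (deriv χ) := by
          ext x; simp [Set.indicator]
        rw [e, integral_indicator measurableSet_Ici, integral_Ici_eq_integral_Ioi]
        have := integral_Ioi_of_hasDerivAt_of_tendsto (a := t) (f := χ) (f' := deriv χ) (m := 0)
          hχ.continuous.continuousWithinAt
          (fun x _ => (hχ.differentiable (by norm_num) x).hasDerivAt) hdi.integrableOn ?_
        · simpa using this
        · refine tendsto_const_nhds.congr' ?_
          filter_upwards [eventually_gt_atTop b] with x hx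
          exact (h0 x fun h => absurd h.2 (not_lt.2 hx.le)).symm
      rw [this, Set.indicator_of_mem ht, neg_smul]
    · have : χ t = 0 := h0 t fun h => ht ⟨h.1, h.2.le⟩
      simp [ht, this]
  simp_rw [hL]
  rw [integral_integral_swap]
  · simp_rw [hR]; rw [integral_neg]
  · have hi : Integrable (fun p : ℝ × ℝ => deriv χ p.1 • (Set.Ioc a b).indicator g p.2)
        ((volume : Measure ℝ).prod volume) :=
      hdi.smul_prod ((integrable_indicator_iff measurableSet_Ioc).2 hg1)
    have hm : MeasurableSet {p : ℝ × ℝ | p.2 ≤ p.1} :=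
      measurableSet_le measurable_snd measurable_fst
    refine (hi.indicator hm).congr (Eventually.of_forall fun p => ?_)
    by_cases hp : p.2 ≤ p.1 <;> simp [Set.indicator, hp, Function.uncurry]

/-- On an interval without points of `Y`, a function with weak derivative `g` is a primitive
of `g`. -/
theorem HasWeakDeriv.exists_eq_primitive {V : Type*} [NormedAddCommGroup V] [NormedSpace ℂ V]
    [CompleteSpace V] {Y : Finset ℝ} {f g : L2 V}
    (h : HasWeakDeriv Y f g) {a b : ℝ} (hab : a < b) (hY : Disjoint (Set.Ioo a b) (Y : Set ℝ)) :
    ∃ c : V, ∀ᵐ x ∂volume, x ∈ Set.Ioo a b → f x = c + ∫ t in a..x, g t := by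
  have hgi : ∀ u v, IntervalIntegrable g volume u v := fun u v =>
    ((locallyIntegrable_L2 g).integrableOn_isCompact isCompact_uIcc).intervalIntegrable
  have hF : Continuous fun x => ∫ t in a..x, g t :=
    intervalIntegral.continuous_primitive hgi a
  set k : ℝ → V := fun x => f x - ∫ t in a..x, g t with hk
  have hkl : LocallyIntegrable k volume := (locallyIntegrable_L2 f).sub hF.locallyIntegrable
  let B : ContDiffBump ((a + b) / 2) := ⟨(b - a) / 8, (b - a) / 4, by linarith, by linarith⟩
  set ψ : ℝ → ℝ := B.normed volume with hψ
  have hψd : ContDiff ℝ ∞ ψ := B.contDiff_normed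
  have hψc : HasCompactSupport ψ := B.hasCompactSupport_normed
  have hψs : tsupport ψ ⊆ Set.Ioo a b := by
    rw [hψ, B.tsupport_normed_eq, Real.closedBall_eq_Icc]
    intro x hx
    have h1 := hx.1
    have h2 := hx.2
    simp only [B] at h1 h2
    constructor <;> linarith
  have hψ1 : ∫ x, ψ x = 1 := B.integral_normed
  refine ⟨∫ x, ψ x • k x, ?_⟩
  have key := (isOpen_Ioo (a := a) (b := b)).ae_eq_zero_of_integral_contDiff_smul_eq_zero
    (μ := volume) (f := fun x => k x - ∫ x, ψ x • k x)
    ((hkl.sub (locallyIntegrable_const _)).locallyIntegrableOn _) (by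
      intro φ hφ hc hs
      have i1 := integrable_test_smul hφ.continuous hc hkl
      have i2 := integrable_test_smul hψd.continuous hψc hkl
      have i3 : Integrable φ := hφ.continuous.integrable_of_hasCompactSupport hc
      have i4 : Integrable ψ := hψd.continuous.integrable_of_hasCompactSupport hψc
      set m : ℝ := ∫ x, φ x with hm
      set η : ℝ → ℝ := fun x => φ x - m * ψ x with hη
      have hηd : ContDiff ℝ ∞ η := hφ.sub (contDiff_const.mul hψd)
      set χ : ℝ → ℝ := fun x => ∫ t in a..x, η t with hχ
      have hχ' : deriv χ = η := by
        ext x; exact Continuous.deriv_integral _ hηd.continuous a x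
      have hχd : ContDiff ℝ ∞ χ := by
        refine contDiff_infty_iff_deriv.2 ⟨fun x => ?_, hχ' ▸ hηd⟩
        exact (intervalIntegral.integral_hasDerivAt_right
          (hηd.continuous.intervalIntegrable _ _)
          hηd.continuous.stronglyMeasurable.stronglyMeasurableAtFilter
          hηd.continuous.continuousAt).differentiableAt
      -- the support of `η` lies in a compact subinterval
      have hKc : IsCompact (tsupport φ ∪ tsupport ψ) := hc.isCompact.union hψc.isCompact
      have hKs : tsupport φ ∪ tsupport ψ ⊆ Set.Ioo a b := Set.union_subset hs hψs
      have hKn : (tsupport φ ∪ tsupport ψ).Nonempty := by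
        refine Set.Nonempty.inr ?_
        rw [hψ, B.tsupport_normed_eq]
        exact ⟨_, Metric.mem_closedBall_self B.rOut_pos.le⟩
      obtain ⟨p, hp, hpl⟩ := hKc.exists_isLeast hKn
      obtain ⟨q, hq, hqg⟩ := hKc.exists_isGreatest hKn
      have hp' := hKs hp
      have hq' := hKs hq
      have hη0 : ∀ x, x ∉ Set.Icc p q → η x = 0 := by
        intro x hx
        have hx1 : x ∉ tsupport φ := fun h => hx ⟨hpl (Or.inl h), hqg (Or.inl h)⟩
        have hx2 : x ∉ tsupport ψ := fun h => hx ⟨hpl (Or.inr h), hqg (Or.inr h)⟩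
        simp [hη, image_eq_zero_of_notMem_tsupport hx1, image_eq_zero_of_notMem_tsupport hx2]
      have hηint : ∫ x, η x = 0 := by
        rw [hη, integral_sub i3 (i4.const_mul m), integral_const_mul, hψ1]; simp [hm]
      have hχ0 : ∀ x, x ∉ Set.Icc p q → χ x = 0 := by
        intro x hx
        by_cases hxp : x < p
        · refine intervalIntegral.integral_zero_ae (Eventually.of_forall fun t ht => hη0 t ?_)
          intro h2
          rcases Set.mem_uIoc.1 ht with h | h
          · linarith [h2.1, h.2]
          · linarith [h2.1, h.2, hp'.1]
        · have hxq : q < x := by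
            by_contra hxq; exact hx ⟨not_lt.1 hxp, not_lt.1 hxq⟩
          have hpq : p ≤ q := hpl hq
          have hax : a ≤ x := by linarith [hp'.1]
          simp only [hχ]
          rw [intervalIntegral.integral_of_le hax, ← hηint]
          refine setIntegral_eq_integral_of_forall_compl_eq_zero fun t ht => hη0 t fun h2 => ht ?_
          exact ⟨by linarith [h2.1, hp'.1], by linarith [h2.2]⟩
      have hχs : tsupport χ ⊆ Set.Icc p q := by
        refine closure_minimal (fun x hx => ?_) isClosed_Icc
        by_contra hx'
        exact hx (hχ0 x hx')
      have hIcc : Set.Icc p q ⊆ Set.Ioo a b := fun x hx =>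
        ⟨lt_of_lt_of_le hp'.1 hx.1, lt_of_le_of_lt hx.2 hq'.2⟩
      have hχc : HasCompactSupport χ := HasCompactSupport.of_support_subset_isCompact isCompact_Icc
        ((subset_tsupport χ).trans hχs)
      have e1 := h χ hχd hχc (hY.mono_left (hχs.trans hIcc))
      have e2 := integral_deriv_smul_primitive (hχd.of_le (by simp)) (hχs.trans hIcc)
        (locallyIntegrable_L2 g)
      have e3 : ∫ x, η x • k x = 0 := by
        rw [hχ'] at e1 e2
        simp only [hk, smul_sub]
        rw [integral_sub, e1, e2, sub_self]
        · exact integrable_test_smul hηd.continuous (hχ' ▸ hχc.deriv) (locallyIntegrable_L2 f)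
        · exact integrable_test_smul hηd.continuous (hχ' ▸ hχc.deriv) hF.locallyIntegrable
      have e4 : ∫ x, η x • k x = (∫ x, φ x • k x) - m • ∫ x, ψ x • k x := by
        have i5 : Integrable (fun x => m • ψ x • k x) := i2.smul m
        rw [← integral_smul, ← integral_sub i1 i5]
        congr 1; ext x; simp [hη, sub_smul, mul_smul]
      simp only [smul_sub]
      rw [integral_sub i1 (i3.smul_const _), integral_smul_const, ← e4, e3])
  filter_upwards [key] with x hx hxm
  have := hx hxm
  simp only [hk] at this
  rw [sub_sub, sub_eq_zero] at this
  rw [this, add_comm]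

theorem exists_tendsto_right {V : Type*} [NormedAddCommGroup V] [NormedSpace ℂ V]
    [CompleteSpace V] {Y : Finset ℝ} {f g : L2 V} (h : HasWeakDeriv Y f g) (a : ℝ) :
    ∃ c, Tendsto f (𝓝[>] a ⊓ ae volume) (𝓝 c) := by
  have h1 : ((Y.erase a : Finset ℝ) : Set ℝ)ᶜ ∈ 𝓝 a :=
    (Y.erase a).finite_toSet.isClosed.isOpen_compl.mem_nhds (by simp)
  obtain ⟨ε, hε, hb⟩ := Metric.mem_nhds_iff.1 h1
  have hd : Disjoint (Set.Ioo a (a + ε)) (Y : Set ℝ) := by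
    refine Set.disjoint_left.2 fun x hx hy => ?_
    have hm : x ∈ Metric.ball a ε := by
      rw [Real.ball_eq_Ioo]; exact ⟨by linarith [hx.1], hx.2⟩
    refine hb hm ?_
    · simp only [Finset.mem_coe, Finset.mem_erase] at hy ⊢
      exact ⟨hx.1.ne', hy⟩
  obtain ⟨c, hc⟩ := h.exists_eq_primitive (by linarith) hd
  have hF : Continuous fun x => c + ∫ t in a..x, g t :=
    continuous_const.add (intervalIntegral.continuous_primitive (fun u v =>
      ((locallyIntegrable_L2 g).integrableOn_isCompact isCompact_uIcc).intervalIntegrable) a)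
  refine ⟨_, ((hF.tendsto a).mono_left (inf_le_left.trans nhdsWithin_le_nhds)).congr' ?_⟩
  filter_upwards [mem_inf_of_left (Ioo_mem_nhdsGT (show a < a + ε by linarith)),
    mem_inf_of_right hc] with x h1 h2 using (h2 h1).symm

theorem exists_tendsto_left {V : Type*} [NormedAddCommGroup V] [NormedSpace ℂ V]
    [CompleteSpace V] {Y : Finset ℝ} {f g : L2 V} (h : HasWeakDeriv Y f g) (b : ℝ) :
    ∃ c, Tendsto f (𝓝[<] b ⊓ ae volume) (𝓝 c) := by
  have h1 : ((Y.erase b : Finset ℝ) : Set ℝ)ᶜ ∈ 𝓝 b :=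
    (Y.erase b).finite_toSet.isClosed.isOpen_compl.mem_nhds (by simp)
  obtain ⟨ε, hε, hb⟩ := Metric.mem_nhds_iff.1 h1
  have hd : Disjoint (Set.Ioo (b - ε) b) (Y : Set ℝ) := by
    refine Set.disjoint_left.2 fun x hx hy => ?_
    have hm : x ∈ Metric.ball b ε := by
      rw [Real.ball_eq_Ioo]; exact ⟨hx.1, by linarith [hx.2]⟩
    refine hb hm ?_
    · simp only [Finset.mem_coe, Finset.mem_erase] at hy ⊢
      exact ⟨hx.2.ne, hy⟩
  obtain ⟨c, hc⟩ := h.exists_eq_primitive (by linarith) hd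
  have hF : Continuous fun x => c + ∫ t in (b - ε)..x, g t :=
    continuous_const.add (intervalIntegral.continuous_primitive (fun u v =>
      ((locallyIntegrable_L2 g).integrableOn_isCompact isCompact_uIcc).intervalIntegrable) _)
  refine ⟨_, ((hF.tendsto b).mono_left (inf_le_left.trans nhdsWithin_le_nhds)).congr' ?_⟩
  filter_upwards [mem_inf_of_left (Ioo_mem_nhdsLT (show b - ε < b by linarith)),
    mem_inf_of_right hc] with x h1 h2 using (h2 h1).symm

theorem neBot_right (a : ℝ) : (𝓝[>] a ⊓ ae (volume : Measure ℝ)).NeBot := by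
  rw [inf_neBot_iff]
  intro s hs t ht
  obtain ⟨b, hb, hs'⟩ := (mem_nhdsGT_iff_exists_Ioo_subset).1 hs
  by_contra hn
  have h0 : volume (Set.Ioo a b) = 0 := by
    refine measure_mono_null (fun x hx hxt => hn ⟨x, hs' hx, hxt⟩) (mem_ae_iff.1 ht)
  simp at h0
  exact absurd hb (not_lt.2 h0)

theorem neBot_left (a : ℝ) : (𝓝[<] a ⊓ ae (volume : Measure ℝ)).NeBot := by
  rw [inf_neBot_iff]
  intro s hs t ht
  obtain ⟨b, hb, hs'⟩ := (mem_nhdsLT_iff_exists_Ioo_subset).1 hs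
  by_contra hn
  have h0 : volume (Set.Ioo b a) = 0 := by
    refine measure_mono_null (fun x hx hxt => hn ⟨x, hs' hx, hxt⟩) (mem_ae_iff.1 ht)
  simp at h0
  exact absurd hb (not_lt.2 h0)

/-- The graph of the distributional derivative on `ℝ ∖ Y`, for functions in `L²` with derivative
in `L²`. -/
def weakDerivGraph (Y : Finset ℝ) (V : Type*) [NormedAddCommGroup V] [NormedSpace ℂ V] :
    Submodule ℂ (L2 V × L2 V) where
  carrier := {p | HasWeakDeriv Y p.1 p.2}
  zero_mem' := by
    intro φ hφ hc hs
    have h0 : ((0 : L2 V) : ℝ → V) =ᵐ[volume] 0 := Lp.coeFn_zero V 2 volume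
    have e1 : ∫ x, deriv φ x • (0 : L2 V) x = 0 := by
      refine integral_eq_zero_of_ae ?_
      filter_upwards [h0] with x hx
      rw [hx]; simp
    have e2 : ∫ x, φ x • (0 : L2 V) x = 0 := by
      refine integral_eq_zero_of_ae ?_
      filter_upwards [h0] with x hx
      rw [hx]; simp
    simp only [Prod.fst_zero, Prod.snd_zero]
    rw [e1, e2, neg_zero]
  add_mem' := by
    rintro ⟨f, g⟩ ⟨f', g'⟩ h h' φ hφ hc hs
    have hdc : Continuous (deriv φ) := hφ.continuous_deriv (by simp)
    have e1 : ∫ x, deriv φ x • (f + f') x = (∫ x, deriv φ x • f x) + ∫ x, deriv φ x • f' x := by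
      rw [← integral_add (integrable_test_smul hdc hc.deriv (locallyIntegrable_L2 f))
        (integrable_test_smul hdc hc.deriv (locallyIntegrable_L2 f'))]
      refine integral_congr_ae ?_
      filter_upwards [Lp.coeFn_add f f'] with x hx
      rw [hx]; simp
    have e2 : ∫ x, φ x • (g + g') x = (∫ x, φ x • g x) + ∫ x, φ x • g' x := by
      rw [← integral_add (integrable_test_smul hφ.continuous hc (locallyIntegrable_L2 g))
        (integrable_test_smul hφ.continuous hc (locallyIntegrable_L2 g'))]
      refine integral_congr_ae ?_
      filter_upwards [Lp.coeFn_add g g'] with x hx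
      rw [hx]; simp
    simp only [Prod.mk_add_mk]
    rw [e1, e2, h φ hφ hc hs, h' φ hφ hc hs, neg_add]
  smul_mem' := by
    rintro c ⟨f, g⟩ h φ hφ hc hs
    have e1 : ∫ x, deriv φ x • (c • f) x = c • ∫ x, deriv φ x • f x := by
      rw [← integral_smul]
      refine integral_congr_ae ?_
      filter_upwards [Lp.coeFn_smul c f] with x hx
      rw [hx, Pi.smul_apply, smul_comm]
    have e2 : ∫ x, φ x • (c • g) x = c • ∫ x, φ x • g x := by
      rw [← integral_smul]
      refine integral_congr_ae ?_
      filter_upwards [Lp.coeFn_smul c g] with x hx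
      rw [hx, Pi.smul_apply, smul_comm]
    simp only [Prod.smul_mk]
    rw [e1, e2, h φ hφ hc hs, smul_neg]

/-- The Sobolev space `H¹(ℝ ∖ Y; V)`; `Y = ∅` gives `H¹(ℝ; V)`. -/
def H1 (Y : Finset ℝ) (V : Type*) [NormedAddCommGroup V] [NormedSpace ℂ V] :
    Submodule ℂ (L2 V) :=
  (weakDerivGraph Y V).map (LinearMap.fst ℂ _ _)

theorem mem_H1 {Y : Finset ℝ} {V : Type*} [NormedAddCommGroup V] [NormedSpace ℂ V] {f : L2 V} :
    f ∈ H1 Y V ↔ ∃ g, HasWeakDeriv Y f g := by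
  constructor
  · rintro ⟨⟨f, g⟩, h, rfl⟩
    exact ⟨g, h⟩
  · rintro ⟨g, h⟩
    exact ⟨(f, g), h, rfl⟩

/-- The distributional derivative `f ↦ f'` on `ℝ ∖ Y`, as a linear map `H¹(ℝ ∖ Y; V) → L²(ℝ; V)`. -/
def weakDeriv (Y : Finset ℝ) (V : Type*) [NormedAddCommGroup V] [NormedSpace ℂ V] :
    H1 Y V →ₗ[ℂ] L2 V :=
  (weakDerivGraph Y V).toLinearPMap.toFun

theorem hasWeakDeriv_weakDeriv {Y : Finset ℝ} {V : Type*} [NormedAddCommGroup V]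
    [NormedSpace ℂ V] [CompleteSpace V] (f : H1 Y V) :
    HasWeakDeriv Y (f : L2 V) (weakDeriv Y V f) := by
  refine Submodule.mem_graph_toLinearPMap (g := weakDerivGraph Y V) ?_ f
  rintro ⟨x, g⟩ h (rfl : x = 0)
  exact HasWeakDeriv.unique h (weakDerivGraph Y V).zero_mem

/-- The Sobolev space `H²(ℝ ∖ Y; V)`: those `f ∈ H¹(ℝ ∖ Y; V)` with `f' ∈ H¹(ℝ ∖ Y; V)`. -/
def H2 (Y : Finset ℝ) (V : Type*) [NormedAddCommGroup V] [NormedSpace ℂ V] :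
    Submodule ℂ (L2 V) :=
  ((H1 Y V).comap (weakDeriv Y V)).map (H1 Y V).subtype

theorem H2_le_H1 (Y : Finset ℝ) (V : Type*) [NormedAddCommGroup V] [NormedSpace ℂ V] :
    H2 Y V ≤ H1 Y V := by
  rintro _ ⟨f, -, rfl⟩
  exact f.2

/-- The distributional derivative on `ℝ ∖ Y`, as a map `H²(ℝ ∖ Y; V) → H¹(ℝ ∖ Y; V)`. -/
def weakDerivH2 (Y : Finset ℝ) (V : Type*) [NormedAddCommGroup V] [NormedSpace ℂ V] :
    H2 Y V →ₗ[ℂ] H1 Y V :=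
  LinearMap.codRestrict (H1 Y V) (weakDeriv Y V ∘ₗ Submodule.inclusion (H2_le_H1 Y V)) (by
    rintro ⟨_, f, hf, rfl⟩
    exact hf)

/-! ### Traces -/

/-- The left limit `f(y⁻)`. Null sets are ignored, so that it only depends on the class of `f`. -/
def leftValue {V : Type*} [NormedAddCommGroup V] (f : L2 V) (y : ℝ) : V :=
  limUnder (𝓝[<] y ⊓ ae volume) f

/-- The right limit `f(y⁺)`. Null sets are ignored, so that it only depends on the class of `f`. -/
def rightValue {V : Type*} [NormedAddCommGroup V] (f : L2 V) (y : ℝ) : V :=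
  limUnder (𝓝[>] y ⊓ ae volume) f

theorem tendsto_leftValue {V : Type*} [NormedAddCommGroup V] [NormedSpace ℂ V]
    [CompleteSpace V] {Y : Finset ℝ} (f : H1 Y V) (y : ℝ) :
    Tendsto (f : L2 V) (𝓝[<] y ⊓ ae volume) (𝓝 (leftValue (f : L2 V) y)) :=
  tendsto_nhds_limUnder (exists_tendsto_left (hasWeakDeriv_weakDeriv f) y)

theorem tendsto_rightValue {V : Type*} [NormedAddCommGroup V] [NormedSpace ℂ V]
    [CompleteSpace V] {Y : Finset ℝ} (f : H1 Y V) (y : ℝ) :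
    Tendsto (f : L2 V) (𝓝[>] y ⊓ ae volume) (𝓝 (rightValue (f : L2 V) y)) :=
  tendsto_nhds_limUnder (exists_tendsto_right (hasWeakDeriv_weakDeriv f) y)

/-- The mean value `⟨f⟩_y = (f(y⁻) + f(y⁺)) / 2` of `f ∈ H¹(ℝ ∖ Y; V)`. -/
def meanValue (Y : Finset ℝ) (V : Type*) [NormedAddCommGroup V] [NormedSpace ℂ V]
    [CompleteSpace V] (y : ℝ) : H1 Y V →ₗ[ℂ] V where
  toFun f := (1 / 2 : ℂ) • (leftValue (f : L2 V) y + rightValue (f : L2 V) y)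
  map_add' f f' := by
    have hl := neBot_left y
    have hr := neBot_right y
    have e : ((f + f' : H1 Y V) : L2 V) =ᵐ[volume] fun x => (f : L2 V) x + (f' : L2 V) x :=
      Lp.coeFn_add (f : L2 V) (f' : L2 V)
    have e1 : leftValue ((f + f' : H1 Y V) : L2 V) y
        = leftValue (f : L2 V) y + leftValue (f' : L2 V) y :=
      tendsto_nhds_unique (tendsto_leftValue (f + f') y)
        (((tendsto_leftValue f y).add (tendsto_leftValue f' y)).congr' (mem_inf_of_right
          (e.mono fun _ h => h.symm)))
    have e2 : rightValue ((f + f' : H1 Y V) : L2 V) y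
        = rightValue (f : L2 V) y + rightValue (f' : L2 V) y :=
      tendsto_nhds_unique (tendsto_rightValue (f + f') y)
        (((tendsto_rightValue f y).add (tendsto_rightValue f' y)).congr' (mem_inf_of_right
          (e.mono fun _ h => h.symm)))
    rw [e1, e2, ← smul_add]
    congr 1
    abel
  map_smul' c f := by
    have hl := neBot_left y
    have hr := neBot_right y
    have e : ((c • f : H1 Y V) : L2 V) =ᵐ[volume] fun x => c • (f : L2 V) x :=
      Lp.coeFn_smul c (f : L2 V)
    have e1 : leftValue ((c • f : H1 Y V) : L2 V) y = c • leftValue (f : L2 V) y :=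
      tendsto_nhds_unique (tendsto_leftValue (c • f) y)
        (((tendsto_leftValue f y).const_smul c).congr' (mem_inf_of_right
          (e.mono fun _ h => h.symm)))
    have e2 : rightValue ((c • f : H1 Y V) : L2 V) y = c • rightValue (f : L2 V) y :=
      tendsto_nhds_unique (tendsto_rightValue (c • f) y)
        (((tendsto_rightValue f y).const_smul c).congr' (mem_inf_of_right
          (e.mono fun _ h => h.symm)))
    rw [e1, e2, ← smul_add, smul_comm]
    rfl

/-- The space `ℂ²`. -/
abbrev C2 : Type := EuclideanSpace ℂ (Fin 2)

/-- The space `ℂ²ⁿ = (ℂ²)ⁿ`, with elements `ξ = (ξ_{k,j})`, `k < n`, `j < 2`. -/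
abbrev C2n (n : ℕ) : Type := EuclideanSpace ℂ (Fin n × Fin 2)

/-- The set `Y = {y_1, …, y_n}`. -/
def points {n : ℕ} (y : Fin n → ℝ) : Finset ℝ := Finset.univ.image y

/-- The trace `τ : H¹(ℝ ∖ Y; ℂ²) → ℂ²ⁿ`, `τΨ = (⟨Ψ⟩_{y_1}, …, ⟨Ψ⟩_{y_n})`. -/
def traceDirac {n : ℕ} (y : Fin n → ℝ) : L2 C2 →ₗ.[ℂ] C2n n where
  domain := H1 (points y) C2
  toFun := (WithLp.linearEquiv 2 ℂ (Fin n × Fin 2 → ℂ)).symm.toLinearMap ∘ₗ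
    LinearMap.pi fun p =>
      (EuclideanSpace.proj (𝕜 := ℂ) p.2).toLinearMap ∘ₗ meanValue (points y) C2 (y p.1)

/-- The trace `τ̂ : H²(ℝ ∖ Y) → ℂ²ⁿ`, `τ̂ψ = (⟨ψ⟩_{y_1} ⊕ ⟨ψ'⟩_{y_1}, …, ⟨ψ⟩_{y_n} ⊕ ⟨ψ'⟩_{y_n})`. -/
def traceSchr {n : ℕ} (y : Fin n → ℝ) : L2 ℂ →ₗ.[ℂ] C2n n where
  domain := H2 (points y) ℂ
  toFun := (WithLp.linearEquiv 2 ℂ (Fin n × Fin 2 → ℂ)).symm.toLinearMap ∘ₗ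
    LinearMap.pi fun p =>
      ![meanValue (points y) ℂ (y p.1) ∘ₗ Submodule.inclusion (H2_le_H1 (points y) ℂ),
        meanValue (points y) ℂ (y p.1) ∘ₗ weakDerivH2 (points y) ℂ] p.2

/-! ### The free operators -/

/-- A matrix acting pointwise on `L²(ℝ; ℂ²)`. -/
def matrixAct (M : Matrix (Fin 2) (Fin 2) ℂ) : L2 C2 →L[ℂ] L2 C2 :=
  (Matrix.toEuclideanCLM (𝕜 := ℂ) M).compLpL 2 volume

/-- The free Dirac operator `D = -i (d/dx) σ₁ + σ₃ / 2` with domain `H¹(ℝ; ℂ²)`. -/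
def freeDirac : L2 C2 →ₗ.[ℂ] L2 C2 where
  domain := H1 ∅ C2
  toFun := (-Complex.I) • ((matrixAct !![0, 1; 1, 0]).toLinearMap ∘ₗ weakDeriv ∅ C2)
    + (1 / 2 : ℂ) • ((matrixAct !![1, 0; 0, -1]).toLinearMap ∘ₗ (H1 ∅ C2).subtype)

/-- The free Schrödinger operator `H = -d²/dx²` with domain `H²(ℝ)`. -/
def freeSchr : L2 ℂ →ₗ.[ℂ] L2 ℂ where
  domain := H2 ∅ ℂ
  toFun := -(weakDeriv ∅ ℂ ∘ₗ weakDerivH2 ∅ ℂ)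

/-- The restriction `A | ker(τ | dom A)`. -/
def restrictKer {E K : Type*} [NormedAddCommGroup E] [InnerProductSpace ℂ E]
    [NormedAddCommGroup K] [InnerProductSpace ℂ K] (A : E →ₗ.[ℂ] E) (τ : E →ₗ.[ℂ] K) :
    E →ₗ.[ℂ] E :=
  A.domRestrict ((LinearMap.ker τ.toFun).map τ.domain.subtype)

/-- The self-adjoint extensions of `S`. -/
abbrev SelfAdjointExt {E : Type*} [NormedAddCommGroup E] [InnerProductSpace ℂ E]
    [CompleteSpace E] (S : E →ₗ.[ℂ] E) : Type _ :=
  {A : E →ₗ.[ℂ] E // IsSelfAdjoint A ∧ S ≤ A}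

/-! ### Resolvents and the operators `G_z`, `τ G_z` -/

/-- `R` is a bounded inverse of `-A + z : dom A → E`. -/
def IsResolventAt {E : Type*} [NormedAddCommGroup E] [InnerProductSpace ℂ E]
    (A : E →ₗ.[ℂ] E) (z : ℂ) (R : E →L[ℂ] E) : Prop :=
  (∀ φ, ∃ h : R φ ∈ A.domain, -A ⟨R φ, h⟩ + z • R φ = φ) ∧
    ∀ ψ : A.domain, R (-A ψ + z • (ψ : E)) = ψ

/-- The resolvent set `ϱ(A)` of a (closed) operator `A`. -/
def resSet {E : Type*} [NormedAddCommGroup E] [InnerProductSpace ℂ E] (A : E →ₗ.[ℂ] E) : Set ℂ :=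
  {z | ∃ R : E →L[ℂ] E, IsResolventAt A z R}

open scoped Classical in
/-- The resolvent `(-A + z)⁻¹` for `z ∈ ϱ(A)` (and `0` for other `z`). -/
def res {E : Type*} [NormedAddCommGroup E] [InnerProductSpace ℂ E] (A : E →ₗ.[ℂ] E) (z : ℂ) :
    E →L[ℂ] E :=
  if h : ∃ R : E →L[ℂ] E, IsResolventAt A z R then h.choose else 0

theorem isResolventAt_res {E : Type*} [NormedAddCommGroup E] [InnerProductSpace ℂ E]
    {A : E →ₗ.[ℂ] E} {z : ℂ} (h : z ∈ resSet A) : IsResolventAt A z (res A z) := by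
  have h' : ∃ R : E →L[ℂ] E, IsResolventAt A z R := h
  rw [res, dif_pos h']
  exact h'.choose_spec

/-- `M = τ T`: the operator `T` takes values in `dom τ` and `M x = τ (T x)` for all `x`. -/
def IsComp {E F K : Type*} [NormedAddCommGroup E] [InnerProductSpace ℂ E]
    [NormedAddCommGroup F] [InnerProductSpace ℂ F] [NormedAddCommGroup K] [InnerProductSpace ℂ K]
    (τ : E →ₗ.[ℂ] K) (T : F →L[ℂ] E) (M : F →L[ℂ] K) : Prop :=
  ∀ x, ∃ h : T x ∈ τ.domain, τ ⟨T x, h⟩ = M x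

open scoped Classical in
/-- The bounded operator `τ T` (and `0` if `τ T` is not an everywhere defined bounded operator). -/
def comp {E F K : Type*} [NormedAddCommGroup E] [InnerProductSpace ℂ E]
    [NormedAddCommGroup F] [InnerProductSpace ℂ F] [NormedAddCommGroup K] [InnerProductSpace ℂ K]
    (τ : E →ₗ.[ℂ] K) (T : F →L[ℂ] E) : F →L[ℂ] K :=
  if h : ∃ M : F →L[ℂ] K, IsComp τ T M then h.choose else 0

theorem IsComp.comp_eq {E F K : Type*} [NormedAddCommGroup E] [InnerProductSpace ℂ E]
    [NormedAddCommGroup F] [InnerProductSpace ℂ F] [NormedAddCommGroup K] [InnerProductSpace ℂ K]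
    {τ : E →ₗ.[ℂ] K} {T : F →L[ℂ] E} {M : F →L[ℂ] K} (h : IsComp τ T M) : comp τ T = M := by
  have h' : ∃ M : F →L[ℂ] K, IsComp τ T M := ⟨M, h⟩
  rw [comp, dif_pos h']
  ext x
  obtain ⟨h1, e1⟩ := h'.choose_spec x
  obtain ⟨h2, e2⟩ := h x
  rw [← e1, ← e2]

/-- The operator `G_z = (τ (-A + z̄)⁻¹)*`. -/
def gField {E K : Type*} [NormedAddCommGroup E] [InnerProductSpace ℂ E] [CompleteSpace E]
    [NormedAddCommGroup K] [InnerProductSpace ℂ K] [CompleteSpace K]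
    (A : E →ₗ.[ℂ] E) (τ : E →ₗ.[ℂ] K) (z : ℂ) : K →L[ℂ] E :=
  ContinuousLinearMap.adjoint (comp τ (res A (starRingEnd ℂ z)))

/-! ### The parameters -/

/-- A couple `(Π, Θ)`: an orthogonal projector `Π` and a symmetric operator `Θ` on `ran Π`. -/
structure ExtParam (K : Type*) [NormedAddCommGroup K] [InnerProductSpace ℂ K]
    [CompleteSpace K] where
  proj : K →L[ℂ] K
  isStarProjection : IsStarProjection proj
  op : proj.range →ₗ[ℂ] proj.range
  isSymmetric : op.IsSymmetric

/-- The operator `Θ - Π τ G_z Π` on `ran Π`. -/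
def kreinGamma {E K : Type*} [NormedAddCommGroup E] [InnerProductSpace ℂ E] [CompleteSpace E]
    [NormedAddCommGroup K] [InnerProductSpace ℂ K] [CompleteSpace K]
    (A : E →ₗ.[ℂ] E) (τ : E →ₗ.[ℂ] K) (p : ExtParam K) (z : ℂ) :
    p.proj.range →ₗ[ℂ] p.proj.range :=
  p.op - p.proj.rangeRestrict.toLinearMap ∘ₗ (comp τ (gField A τ z)).toLinearMap ∘ₗ
    p.proj.range.subtype

end

end PointInteraction

open PointInteraction

/-!
The proof goes through boundary triples. Let `T` be the maximal operator, that is, `-i σ₁ d/dx + σ₃/2`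
on `H¹(ℝ ∖ Y; ℂ²)` or `-d²/dx²` on `H²(ℝ ∖ Y)`. The jump of a product is
`[f g] = [f]⟨g⟩ + ⟨f⟩[g]`, so that integration by parts on `ℝ ∖ Y` gives Green's identity

  `⟪T u, v⟫ - ⟪u, T v⟫ = ⟪ρ u, τ v⟫ - ⟪τ u, ρ v⟫`,

where `τ` is the given trace by mean values and `ρ` collects the jumps: `ρ Ψ = (i σ₁ [Ψ]_{y_k})_k`
for the Dirac operator, `ρ ψ = ([ψ']_{y_k}, -[ψ]_{y_k})_k` for the Schrödinger operator. The jumps can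
be prescribed at will, and the free operator `A` is the restriction of `T` to `ker ρ`. Together with
the surjectivity of `-A + z₀` for a single real `z₀`, these facts make up the structure
`BoundaryTriple`; everything else is a formal consequence of them:

* `A` is self-adjoint, and `G_z ξ` is the solution `v` of `T v = z v` with `ρ v = ξ`
  (`BoundaryTriple.gField_spec`): Green's identity turns `⟪τ (-A + z̄)⁻¹ f, ξ⟫` into `⟪f, v⟫`. The
  boundedness of `τ (-A + z)⁻¹` comes out of the same computation, without a Sobolev inequality.
* `G_z` is injective, hence `τ` is onto on `ker ρ`, and `(ρ, τ)` is onto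
  (`BoundaryTriple.exists_jump_trace`).
* The adjoint of `S = A | ker τ` is contained in `T` (`BoundaryTriple.mem_of_inner_minimal`), so that
  a self-adjoint extension of `S` is a restriction of `T` by a condition `(ρ u, τ u) ∈ L`. By Green's
  identity it is self-adjoint exactly when `L` is Lagrangian, and the Lagrangian subspaces are the
  relations `{(ξ, η) : ξ ∈ ran Π, Π η = Θ ξ}` (`ExtParam.exists_relation_eq`). This is the bijection
  `BoundaryTriple.extEquiv`.
* In `u = u_z + G_z ξ` with `u_z ∈ dom A` one has `ξ = ρ u`, which gives the description of the domain,
  the uniqueness of the decomposition, and its independence of `z`. Inserting `u = (-A_{Π,Θ} + z)⁻¹ f`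
  in the boundary condition gives the resolvent formula.

On the analytic side, Green's identity (`HasWeakDeriv.inner_add_inner`) follows from Fubini's theorem
on the intervals between the points of `Y`, and the equation `-a² u'' + u = f`
(`exists_second_order`) is solved by projecting `(f, 0)` onto the graph of `a d/dx`. This gives
`z₀ = -1` for the Schrödinger operator, and `z₀ = 0` for the Dirac operator, whose square is
`-d²/dx² + 1/4`.
-/

namespace PointInteraction
noncomputable section

local notation "⟪" x ", " y "⟫" => inner ℂ x y

/-! ### Resolvents of symmetric operators -/

section AbstractTriple

variable {E K : Type*} [NormedAddCommGroup E] [InnerProductSpace ℂ E]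
  [NormedAddCommGroup K] [InnerProductSpace ℂ K]

section Resolvent

variable {B : E →ₗ.[ℂ] E} {z : ℂ}

theorem res_mem (h : z ∈ resSet B) (f : E) : res B z f ∈ B.domain :=
  ((isResolventAt_res h).1 f).1

theorem apply_res (h : z ∈ resSet B) (f : E) :
    B ⟨res B z f, res_mem h f⟩ = z • res B z f - f := by
  obtain ⟨hm, e⟩ := (isResolventAt_res h).1 f
  exact eq_sub_of_add_eq (eq_neg_add_iff_add_eq.1 e.symm)

theorem res_apply_eq (h : z ∈ resSet B) (u : B.domain) : res B z (-B u + z • (u : E)) = u :=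
  (isResolventAt_res h).2 u

/-- If `B` is symmetric and `-B + t` is onto for a real `t`, then `t` is in the resolvent set: the
inverse is symmetric and everywhere defined, hence bounded by the Hellinger-Toeplitz theorem. -/
theorem real_mem_resSet [CompleteSpace E]
    (hs : ∀ u v : B.domain, ⟪B u, (v : E)⟫ = ⟪(u : E), B v⟫) (t : ℝ)
    (hsurj : ∀ f : E, ∃ u : B.domain, -B u + (t : ℂ) • (u : E) = f) : (t : ℂ) ∈ resSet B := by
  set N : B.domain →ₗ[ℂ] E := -B.toFun + (t : ℂ) • B.domain.subtype with hN
  have hNa : ∀ u, N u = -B u + (t : ℂ) • (u : E) := fun u => rfl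
  have hsym : ∀ u v : B.domain, ⟪N u, (v : E)⟫ = ⟪(u : E), N v⟫ := by
    intro u v
    simp only [hNa, inner_add_left, inner_add_right, inner_neg_left, inner_neg_right, hs,
      inner_smul_left, inner_smul_right, Complex.conj_ofReal]
  have hinj : Function.Injective N := by
    rw [← LinearMap.ker_eq_bot, LinearMap.ker_eq_bot']
    intro u hu
    obtain ⟨v, hv⟩ := hsurj u
    have h1 := hsym u v
    rw [hu, inner_zero_left, hNa, hv] at h1
    exact Subtype.ext (inner_self_eq_zero.1 h1.symm)
  let e := LinearEquiv.ofBijective N ⟨hinj, hsurj⟩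
  let R : E →ₗ[ℂ] E := B.domain.subtype ∘ₗ e.symm.toLinearMap
  have hR : R.IsSymmetric := by
    intro f g
    have h1 := hsym (e.symm f) (e.symm g)
    have ef : N (e.symm f) = f := e.apply_symm_apply f
    have eg : N (e.symm g) = g := e.apply_symm_apply g
    rw [ef, eg] at h1
    exact h1.symm
  refine ⟨⟨R, hR.continuous⟩, fun f => ⟨(e.symm f).2, ?_⟩, fun u => ?_⟩
  · exact e.apply_symm_apply f
  · have : e.symm (N u) = u := e.symm_apply_apply u
    exact congrArg Subtype.val this

end Resolvent

section Adjoint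

variable [CompleteSpace E]

/-- A densely defined symmetric operator is self-adjoint if its domain contains that of its
adjoint. -/
theorem isSelfAdjoint_of_adjoint_le {B : E →ₗ.[ℂ] E} (hd : Dense (B.domain : Set E))
    (hs : ∀ u v : B.domain, ⟪B u, (v : E)⟫ = ⟪(u : E), B v⟫)
    (hm : ∀ x w : E, (∀ u : B.domain, ⟪x, B u⟫ = ⟪w, (u : E)⟫) → x ∈ B.domain) :
    IsSelfAdjoint B := by
  rw [LinearPMap.isSelfAdjoint_def]
  have hle : B ≤ B.adjoint := LinearPMap.IsFormalAdjoint.le_adjoint hd hs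
  refine (LinearPMap.eq_of_le_of_domain_eq hle (le_antisymm hle.1 fun x hx => ?_)).symm
  exact hm x (B.adjoint ⟨x, hx⟩) fun u => (LinearPMap.adjoint_isFormalAdjoint hd ⟨x, hx⟩ u).symm

theorem inner_apply_eq_of_isSelfAdjoint {B : E →ₗ.[ℂ] E} (hB : IsSelfAdjoint B) (u v : B.domain) :
    ⟪B u, (v : E)⟫ = ⟪(u : E), B v⟫ := by
  have h := LinearPMap.adjoint_isFormalAdjoint hB.dense_domain
  rw [LinearPMap.isSelfAdjoint_def.1 hB] at h
  exact h u v

theorem mem_domain_of_isSelfAdjoint {B : E →ₗ.[ℂ] E} (hB : IsSelfAdjoint B) {x w : E}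
    (h : ∀ u : B.domain, ⟪x, B u⟫ = ⟪w, (u : E)⟫) : x ∈ B.domain := by
  have h1 : x ∈ B.adjoint.domain :=
    LinearPMap.mem_adjoint_domain_of_exists x ⟨w, fun u => (h u).symm⟩
  rwa [LinearPMap.isSelfAdjoint_def.1 hB] at h1

/-- The resolvent set of a symmetric operator that contains its adjoint is symmetric about the real
axis: the adjoint of the resolvent at `z` is the resolvent at `z̄`. -/
theorem conj_mem_resSet {B : E →ₗ.[ℂ] E} {z : ℂ}
    (hs : ∀ u v : B.domain, ⟪B u, (v : E)⟫ = ⟪(u : E), B v⟫)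
    (hm : ∀ x w : E, (∀ u : B.domain, ⟪x, B u⟫ = ⟪w, (u : E)⟫) →
      ∃ h : x ∈ B.domain, B ⟨x, h⟩ = w)
    (h : z ∈ resSet B) : (starRingEnd ℂ) z ∈ resSet B := by
  refine ⟨ContinuousLinearMap.adjoint (res B z), fun f => ?_, fun u => ?_⟩
  · set x := ContinuousLinearMap.adjoint (res B z) f with hx
    obtain ⟨hd, e⟩ := hm x (starRingEnd ℂ z • x - f) fun u => by
      have h1 : ⟪x, -B u + z • (u : E)⟫ = ⟪f, (u : E)⟫ := by
        rw [hx, ContinuousLinearMap.adjoint_inner_left, res_apply_eq h]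
      rw [inner_add_right, inner_neg_right, inner_smul_right] at h1
      rw [inner_sub_left, inner_smul_left, ← h1]
      simp
    exact ⟨hd, by rw [e]; abel⟩
  · refine ext_inner_right ℂ fun f => ?_
    have h2 := hs u ⟨res B z f, res_mem h f⟩
    rw [apply_res h] at h2
    rw [ContinuousLinearMap.adjoint_inner_left, inner_add_left, inner_neg_left, h2,
      inner_sub_right, inner_smul_right, inner_smul_left]
    simp

end Adjoint

/-! ### Boundary triples -/

/-- A boundary triple for `A` and `τ`: a maximal operator `T = maxOp` on `dom τ` and a second trace
`jump` such that Green's identity holds, `A` is the restriction of `T` to `ker jump`, and `-A + z₀` is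
onto for one real `z₀ = basePoint`. Only the surjectivity of `jump` is required, as the joint
surjectivity of `(jump, τ)` follows. -/
structure BoundaryTriple (A : E →ₗ.[ℂ] E) (τ : E →ₗ.[ℂ] K) where
  maxOp : τ.domain →ₗ[ℂ] E
  jump : τ.domain →ₗ[ℂ] K
  green : ∀ u v : τ.domain, ⟪maxOp u, (v : E)⟫ - ⟪(u : E), maxOp v⟫
    = ⟪jump u, τ v⟫ - ⟪τ u, jump v⟫
  jump_surjective : Function.Surjective jump
  domain_le : A.domain ≤ τ.domain
  mem_domain_iff : ∀ u : τ.domain, (u : E) ∈ A.domain ↔ jump u = 0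
  apply_eq : ∀ u : A.domain, A u = maxOp ⟨u, domain_le u.2⟩
  basePoint : ℝ
  surjective_base : ∀ f : E, ∃ u : A.domain, -A u + (basePoint : ℂ) • (u : E) = f

namespace BoundaryTriple

variable {A : E →ₗ.[ℂ] E} {τ : E →ₗ.[ℂ] K} (b : BoundaryTriple A τ)
include b

theorem symm_apply (u v : A.domain) : ⟪A u, (v : E)⟫ = ⟪(u : E), A v⟫ := by
  have h := b.green ⟨u, b.domain_le u.2⟩ ⟨v, b.domain_le v.2⟩
  rw [(b.mem_domain_iff ⟨u, b.domain_le u.2⟩).1 u.2,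
    (b.mem_domain_iff ⟨v, b.domain_le v.2⟩).1 v.2, inner_zero_left, inner_zero_right, sub_zero,
    ← b.apply_eq, ← b.apply_eq] at h
  exact sub_eq_zero.1 h

theorem base_mem [CompleteSpace E] : (b.basePoint : ℂ) ∈ resSet A :=
  real_mem_resSet b.symm_apply b.basePoint b.surjective_base

theorem mem_of_inner (x w : E) (h : ∀ u : A.domain, ⟪x, A u⟫ = ⟪w, (u : E)⟫) :
    ∃ hx : x ∈ A.domain, A ⟨x, hx⟩ = w := by
  obtain ⟨x', hx'⟩ := b.surjective_base (-w + (b.basePoint : ℂ) • x)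
  have key : x = x' := by
    obtain ⟨u, hu⟩ := b.surjective_base (x - x')
    rw [← sub_eq_zero, ← inner_self_eq_zero (𝕜 := ℂ)]
    nth_rw 2 [← hu]
    have h1 : ⟪(x' : E), -A u + (b.basePoint : ℂ) • (u : E)⟫
        = ⟪-w + (b.basePoint : ℂ) • x, (u : E)⟫ := by
      rw [← hx', inner_add_right, inner_add_left, inner_neg_left, inner_neg_right, b.symm_apply,
        inner_smul_left, inner_smul_right, Complex.conj_ofReal]
    rw [inner_sub_left, h1, inner_add_right, inner_add_left, inner_neg_left, inner_neg_right, h,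
      inner_smul_left, inner_smul_right, Complex.conj_ofReal, sub_self]
  subst key
  refine ⟨x'.2, ?_⟩
  have := add_right_cancel hx'
  simpa using this

theorem conj_mem [CompleteSpace E] {z : ℂ} (h : z ∈ resSet A) : (starRingEnd ℂ) z ∈ resSet A :=
  conj_mem_resSet b.symm_apply b.mem_of_inner h

/-- A solution of `T v = z v` with jump `ξ`: correct any `ψ` with jump `ξ` by an element of
`dom A`. -/
theorem exists_deficiency {z : ℂ} (h : z ∈ resSet A) (ξ : K) :
    ∃ v : τ.domain, b.maxOp v = z • (v : E) ∧ b.jump v = ξ := by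
  obtain ⟨ψ, hψ⟩ := b.jump_surjective ξ
  have hm := res_mem h (-b.maxOp ψ + z • (ψ : E))
  refine ⟨ψ - ⟨_, b.domain_le hm⟩, ?_, ?_⟩
  · rw [map_sub, ← b.apply_eq ⟨_, hm⟩, apply_res h, Submodule.coe_sub, smul_sub]
    abel
  · rw [map_sub, hψ, (b.mem_domain_iff ⟨_, b.domain_le hm⟩).1 hm, sub_zero]

/-- Green's identity for a resolvent and a solution of `T v = z v`: this is what identifies the
adjoint `G_z` of `τ (-A + z̄)⁻¹` and, for fixed `v`, what makes `f ↦ ⟪τ (-A + z̄)⁻¹ f, jump v⟫`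
continuous. -/
theorem inner_trace_res {z : ℂ} (h : (starRingEnd ℂ) z ∈ resSet A) {v : τ.domain}
    (hv : b.maxOp v = z • (v : E)) (f : E) :
    ⟪τ ⟨res A (starRingEnd ℂ z) f, b.domain_le (res_mem h f)⟩, b.jump v⟫ = ⟪f, (v : E)⟫ := by
  have hg := b.green ⟨_, b.domain_le (res_mem h f)⟩ v
  rw [(b.mem_domain_iff ⟨_, b.domain_le (res_mem h f)⟩).1 (res_mem h f), ← b.apply_eq ⟨_, res_mem h f⟩,
    apply_res h, hv, inner_zero_left, zero_sub, inner_sub_left, inner_smul_left,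
    inner_smul_right, Complex.conj_conj] at hg
  linear_combination hg

section FiniteDimensional

variable [FiniteDimensional ℂ K] [CompleteSpace E]

theorem isComp_res {z : ℂ} (h : z ∈ resSet A) : IsComp τ (res A z) (comp τ (res A z)) := by
  let M : E →ₗ[ℂ] K := τ.toFun ∘ₗ LinearMap.codRestrict τ.domain (res A z).toLinearMap
    fun f => b.domain_le (res_mem h f)
  have hM : ∀ f, M f = τ ⟨res A z f, b.domain_le (res_mem h f)⟩ := fun f => rfl
  have hc : Continuous M := by
    have hz : (starRingEnd ℂ) (starRingEnd ℂ z) ∈ resSet A := by rwa [Complex.conj_conj]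
    -- every coordinate functional is the inner product with a deficiency element
    let o := stdOrthonormalBasis ℂ K
    refine (LinearIsometryEquiv.comp_continuous_iff o.repr).1 ?_
    refine (PiLp.continuous_toLp 2 _).comp (continuous_pi fun i => ?_)
    obtain ⟨v, hv, hj⟩ := b.exists_deficiency (b.conj_mem h) (o i)
    have e : (fun f => (o.repr (M f)).ofLp i) = fun f => ⟪(v : E), f⟫ := by
      ext f
      have := b.inner_trace_res hz hv f
      simp only [Complex.conj_conj] at this
      rw [o.repr_apply_apply, hM, ← inner_conj_symm, ← hj, this, inner_conj_symm]
    change Continuous (fun f => (o.repr (M f)).ofLp i)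
    rw [e]
    exact continuous_const.inner continuous_id
  have hI : IsComp τ (res A z) ⟨M, hc⟩ := fun f => ⟨b.domain_le (res_mem h f), rfl⟩
  rwa [hI.comp_eq]

theorem comp_res_apply {z : ℂ} (h : z ∈ resSet A) (f : E) :
    comp τ (res A z) f = τ ⟨res A z f, b.domain_le (res_mem h f)⟩ := by
  obtain ⟨_, e⟩ := b.isComp_res h f
  exact e.symm

variable [CompleteSpace K]

/-- `G_z ξ` is the solution of `T v = z v` with jump `ξ`. -/
theorem gField_spec {z : ℂ} (h : z ∈ resSet A) (ξ : K) :
    ∃ hm : gField A τ z ξ ∈ τ.domain, b.maxOp ⟨_, hm⟩ = z • gField A τ z ξ ∧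
      b.jump ⟨_, hm⟩ = ξ := by
  obtain ⟨v, hv, hj⟩ := b.exists_deficiency h ξ
  have e : gField A τ z ξ = v := by
    refine ext_inner_left ℂ fun f => ?_
    rw [gField, ContinuousLinearMap.adjoint_inner_right, b.comp_res_apply (b.conj_mem h), ← hj,
      b.inner_trace_res (b.conj_mem h) hv]
  rw [e]
  exact ⟨v.2, hv, hj⟩

theorem gField_mem {z : ℂ} (h : z ∈ resSet A) (ξ : K) : gField A τ z ξ ∈ τ.domain :=
  (b.gField_spec h ξ).1

theorem maxOp_gField {z : ℂ} (h : z ∈ resSet A) (ξ : K) :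
    b.maxOp ⟨_, b.gField_mem h ξ⟩ = z • gField A τ z ξ := (b.gField_spec h ξ).2.1

theorem jump_gField {z : ℂ} (h : z ∈ resSet A) (ξ : K) :
    b.jump ⟨_, b.gField_mem h ξ⟩ = ξ := (b.gField_spec h ξ).2.2

theorem isComp_gField {z : ℂ} (h : z ∈ resSet A) :
    IsComp τ (gField A τ z) (comp τ (gField A τ z)) := by
  let M : K →ₗ[ℂ] K := τ.toFun ∘ₗ LinearMap.codRestrict τ.domain (gField A τ z).toLinearMap
    fun ξ => b.gField_mem h ξ
  have hI : IsComp τ (gField A τ z) (LinearMap.toContinuousLinearMap M) :=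
    fun ξ => ⟨b.gField_mem h ξ, rfl⟩
  rwa [hI.comp_eq]

theorem comp_gField_apply {z : ℂ} (h : z ∈ resSet A) (ξ : K) :
    comp τ (gField A τ z) ξ = τ ⟨_, b.gField_mem h ξ⟩ := by
  obtain ⟨_, e⟩ := b.isComp_gField h ξ
  exact e.symm

theorem gField_injective {z : ℂ} (h : z ∈ resSet A) : Function.Injective (gField A τ z) := by
  intro ξ η e
  rw [← b.jump_gField h ξ, ← b.jump_gField h η]
  congr 2

/-- The two traces are jointly surjective: on `ker jump = dom A` the trace `τ` is onto, because
the adjoint `G_z` of `τ (-A + z̄)⁻¹` is injective. -/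
theorem exists_jump_trace (ξ η : K) : ∃ u : τ.domain, b.jump u = ξ ∧ τ u = η := by
  have hz := b.base_mem
  have hz' := b.conj_mem hz
  have hsurj : (comp τ (res A (starRingEnd ℂ (b.basePoint : ℂ)))).range = ⊤ := by
    rw [← Submodule.orthogonal_eq_bot_iff, ContinuousLinearMap.orthogonal_range]
    exact LinearMap.ker_eq_bot.2 (b.gField_injective hz)
  obtain ⟨v, hv⟩ := b.jump_surjective ξ
  obtain ⟨f, hf⟩ := LinearMap.range_eq_top.1 hsurj (η - τ v)
  have hf' : τ ⟨_, b.domain_le (res_mem hz' f)⟩ = η - τ v := by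
    rw [← b.comp_res_apply hz' f]; exact hf
  refine ⟨v + ⟨_, b.domain_le (res_mem hz' f)⟩, ?_, ?_⟩
  · rw [map_add, hv, (b.mem_domain_iff ⟨_, b.domain_le (res_mem hz' f)⟩).1 (res_mem hz' f),
      add_zero]
  · rw [LinearPMap.map_add, hf']
    abel

/-- The maximal operator contains the adjoint of `S = A | ker τ`: a solution of the adjoint
equation differs from an element of `dom A` by an element of `(ker τ (-A + z₀)⁻¹)ᗮ = ran G_{z₀}`. -/
theorem mem_of_inner_minimal (x w : E)
    (h : ∀ u : A.domain, τ ⟨u, b.domain_le u.2⟩ = 0 → ⟪x, A u⟫ = ⟪w, (u : E)⟫) :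
    ∃ hx : x ∈ τ.domain, b.maxOp ⟨x, hx⟩ = w := by
  have hz := b.base_mem
  obtain ⟨x₀, hx₀⟩ := b.surjective_base (-w + (b.basePoint : ℂ) • x)
  have hperp : x - x₀ ∈ (comp τ (res A (b.basePoint : ℂ))).kerᗮ := by
    rw [Submodule.mem_orthogonal']
    intro f hf
    have hf' : τ ⟨_, b.domain_le (res_mem hz f)⟩ = 0 := by
      rw [← b.comp_res_apply hz f]; exact hf
    have h1 := h ⟨_, res_mem hz f⟩ hf'
    have h2 := b.symm_apply x₀ ⟨_, res_mem hz f⟩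
    rw [apply_res hz] at h1 h2
    have h3 : ⟪-A x₀ + (b.basePoint : ℂ) • (x₀ : E), res A (b.basePoint : ℂ) f⟫
      = ⟪-w + (b.basePoint : ℂ) • x, res A (b.basePoint : ℂ) f⟫ := by rw [hx₀]
    simp only [inner_add_left, inner_neg_left, inner_sub_right, inner_smul_left, inner_smul_right,
      Complex.conj_ofReal] at h1 h2 h3
    rw [inner_sub_left]
    linear_combination -h1 - h3 - h2
  rw [ContinuousLinearMap.orthogonal_ker] at hperp
  have hcl := (Submodule.closed_of_finiteDimensional
    (ContinuousLinearMap.adjoint (comp τ (res A (b.basePoint : ℂ)))).range).submodule_topologicalClosure_eq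
  rw [hcl] at hperp
  obtain ⟨ξ, hξ⟩ := hperp
  have hξ' : gField A τ (b.basePoint : ℂ) ξ = x - x₀ := by
    rw [gField, Complex.conj_ofReal]; exact hξ
  have hx : x = x₀ + gField A τ (b.basePoint : ℂ) ξ := by rw [hξ']; abel
  have e : (⟨x₀, b.domain_le x₀.2⟩ + ⟨_, b.gField_mem hz ξ⟩ : τ.domain)
      = (x : E) := by rw [hx]; rfl
  have hmem : x ∈ τ.domain := by rw [← e]; exact Subtype.property _
  refine ⟨hmem, ?_⟩
  have e' : (⟨x, hmem⟩ : τ.domain) = ⟨x₀, b.domain_le x₀.2⟩ + ⟨_, b.gField_mem hz ξ⟩ :=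
    Subtype.ext e.symm
  rw [e', map_add, ← b.apply_eq, b.maxOp_gField hz, hξ', smul_sub]
  have h4 : A x₀ = (b.basePoint : ℂ) • (x₀ : E) + w - (b.basePoint : ℂ) • x := by
    have := congrArg (fun t => -t + (b.basePoint : ℂ) • (x₀ : E)) hx₀
    simp only [neg_add_rev, neg_neg] at this
    rw [neg_add_cancel_comm] at this
    rw [this]; abel
  rw [h4]; abel

end FiniteDimensional
end BoundaryTriple

end AbstractTriple

section Extensions

variable {E K : Type*} [NormedAddCommGroup E] [InnerProductSpace ℂ E]
  [NormedAddCommGroup K] [InnerProductSpace ℂ K]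

/-! ### Self-adjoint linear relations -/

/-- A linear relation in `K` that equals its adjoint, that is, a Lagrangian subspace for the form
`⟪r.1, q.2⟫ - ⟪r.2, q.1⟫`. -/
def IsLagrangian (L : Submodule ℂ (K × K)) : Prop :=
  ∀ q, q ∈ L ↔ ∀ r ∈ L, ⟪r.1, q.2⟫ = ⟪r.2, q.1⟫

namespace ExtParam

variable [CompleteSpace K] (p : ExtParam K)

theorem inner_proj (a c : K) : ⟪p.proj a, c⟫ = ⟪a, p.proj c⟫ :=
  (ContinuousLinearMap.isStarProjection_iff_isSymmetricProjection.1
    p.isStarProjection).isSymmetric a c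

theorem proj_proj (a : K) : p.proj (p.proj a) = p.proj a :=
  congrArg (fun T : K →L[ℂ] K => T a) p.isStarProjection.isIdempotentElem

theorem proj_coe (ξ : p.proj.range) : p.proj ξ = ξ := by
  obtain ⟨_, a, rfl⟩ := ξ
  exact p.proj_proj a

theorem inner_coe (ξ : p.proj.range) (c : K) : ⟪(ξ : K), c⟫ = ⟪ξ, p.proj.rangeRestrict c⟫ := by
  nth_rw 1 [← p.proj_coe ξ]
  exact p.inner_proj _ _

theorem rangeRestrict_eq_zero {c : K} : p.proj.rangeRestrict c = 0 ↔ p.proj c = 0 :=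
  Subtype.ext_iff

/-- The linear relation `{(a, c) : a ∈ ran Π, Π c = Θ a}` of a couple `(Π, Θ)`. -/
def relation : Submodule ℂ (K × K) :=
  (LinearMap.ker ((p.op ∘ₗ LinearMap.fst ℂ _ _) -
    (p.proj.rangeRestrict.toLinearMap ∘ₗ LinearMap.snd ℂ p.proj.range K))).map
    (p.proj.range.subtype.prodMap LinearMap.id)

theorem mem_relation {q : K × K} :
    q ∈ p.relation ↔ ∃ ξ : p.proj.range, (ξ : K) = q.1 ∧ p.proj.rangeRestrict q.2 = p.op ξ := by
  constructor
  · rintro ⟨⟨ξ, c⟩, h, rfl⟩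
    exact ⟨ξ, rfl, (sub_eq_zero.1 h).symm⟩
  · rintro ⟨ξ, h1, h2⟩
    exact ⟨⟨ξ, q.2⟩, sub_eq_zero.2 h2.symm, Prod.ext h1 rfl⟩

theorem isLagrangian_relation : IsLagrangian p.relation := by
  rintro ⟨a, c⟩
  constructor
  · rintro h ⟨a', c'⟩ h'
    obtain ⟨η, rfl, hη⟩ := p.mem_relation.1 h
    obtain ⟨ξ, rfl, hξ⟩ := p.mem_relation.1 h'
    dsimp only at *
    rw [p.inner_coe, hη, ← p.isSymmetric, ← hξ, ← inner_conj_symm, ← p.inner_coe, inner_conj_symm]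
  · intro h
    dsimp only at h
    have h0 : ∀ d, p.proj d = 0 → ⟪d, a⟫ = 0 := by
      intro d hd
      have := h (0, d) (p.mem_relation.2 ⟨0, rfl, by
        rw [map_zero]; exact p.rangeRestrict_eq_zero.2 hd⟩)
      simpa using this.symm
    have ha : p.proj a = a := by
      have hd : p.proj (a - p.proj a) = 0 := by rw [map_sub, p.proj_proj, sub_self]
      have h1 := h0 _ hd
      have h2 : ⟪a - p.proj a, p.proj a⟫ = 0 := by
        rw [← p.inner_proj, hd, inner_zero_left]
      have h3 : ⟪a - p.proj a, a - p.proj a⟫ = 0 := by rw [inner_sub_right, h1, h2, sub_zero]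
      exact (sub_eq_zero.1 (inner_self_eq_zero.1 h3)).symm
    refine p.mem_relation.2 ⟨⟨a, a, ha⟩, rfl, ext_inner_left ℂ fun ξ => ?_⟩
    have h1 := h (ξ, p.op ξ) (p.mem_relation.2 ⟨ξ, rfl, Subtype.ext (p.proj_coe _)⟩)
    dsimp only at h1 ⊢
    rw [← p.inner_coe, h1, ← p.isSymmetric]
    rfl

theorem relation_injective : Function.Injective (relation (K := K)) := by
  intro p q h
  have hr : ∀ p q : ExtParam K, p.relation = q.relation → p.proj.range ≤ q.proj.range := by
    intro p q h a ha
    have h1 : (a, (p.op ⟨a, ha⟩ : K)) ∈ p.relation :=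
      p.mem_relation.2 ⟨⟨a, ha⟩, rfl, Subtype.ext (p.proj_coe _)⟩
    rw [h] at h1
    obtain ⟨ξ, h2, -⟩ := q.mem_relation.1 h1
    have h3 : (ξ : K) = a := h2
    exact h3 ▸ ξ.2
  have hproj : p.proj = q.proj :=
    (ContinuousLinearMap.IsStarProjection.ext_iff p.isStarProjection q.isStarProjection).2
      (le_antisymm (hr p q h) (hr q p h.symm))
  obtain ⟨P, hP, S, hS⟩ := p
  obtain ⟨Q, hQ, T, hT⟩ := q
  obtain rfl : P = Q := hproj
  congr 1
  ext ξ : 1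
  have h1 : ((ξ : K), (S ξ : K)) ∈ (⟨P, hP, S, hS⟩ : ExtParam K).relation :=
    (mem_relation _).2 ⟨ξ, rfl, Subtype.ext (proj_coe ⟨P, hP, S, hS⟩ (S ξ))⟩
  rw [h] at h1
  obtain ⟨η, h2, h3⟩ := (mem_relation _).1 h1
  obtain rfl : η = ξ := Subtype.ext h2
  rw [← h3]
  exact (Subtype.ext (proj_coe ⟨P, hP, S, hS⟩ (S η))).symm

/-- Every Lagrangian subspace `L` comes from a couple `(Π, Θ)`: `Π` projects onto the first
projection `N` of `L`, and `Θ a = Π c` for any `(a, c) ∈ L`, which does not depend on `c` because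
`{c : (0, c) ∈ L} = Nᗮ`. -/
theorem exists_relation_eq [FiniteDimensional ℂ K] {L : Submodule ℂ (K × K)}
    (hL : IsLagrangian L) : ∃ p : ExtParam K, p.relation = L := by
  set N : Submodule ℂ K := L.map (LinearMap.fst ℂ K K) with hN
  have hmul : ∀ c, ((0 : K), c) ∈ L ↔ c ∈ Nᗮ := by
    intro c
    rw [hL, Submodule.mem_orthogonal]
    constructor
    · rintro h _ ⟨r, hr, rfl⟩
      simpa using h r hr
    · intro h r hr
      simpa using h r.1 ⟨r, hr, rfl⟩
  have hrange : (N.starProjection).range = N := Submodule.range_starProjection N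
  have hmem : ∀ r : L, r.1.1 ∈ (N.starProjection).range := fun r => hrange.ge ⟨r.1, r.2, rfl⟩
  let q : L →ₗ[ℂ] (N.starProjection).range :=
    LinearMap.codRestrict _ (LinearMap.fst ℂ K K ∘ₗ L.subtype) hmem
  have hq : Function.Surjective q := by
    rintro ⟨a, ha⟩
    obtain ⟨r, hr, e⟩ := hrange.le ha
    exact ⟨⟨r, hr⟩, Subtype.ext e⟩
  obtain ⟨s, hs⟩ := q.exists_rightInverse_of_surjective (LinearMap.range_eq_top.2 hq)
  let Θ : (N.starProjection).range →ₗ[ℂ] (N.starProjection).range :=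
    (N.starProjection).rangeRestrict.toLinearMap ∘ₗ LinearMap.snd ℂ K K ∘ₗ L.subtype ∘ₗ s
  have hs1 : ∀ ξ, ((s ξ : K × K)).1 = ξ := fun ξ =>
    congrArg Subtype.val (LinearMap.congr_fun hs ξ)
  have hΘ : ∀ ξ, (Θ ξ : K) = N.starProjection (s ξ : K × K).2 := fun ξ => rfl
  have hself : ∀ ξ : (N.starProjection).range, N.starProjection (ξ : K) = ξ := fun ξ =>
    Submodule.starProjection_eq_self_iff.2 (hrange.le ξ.2)
  have hsymm : Θ.IsSymmetric := by
    intro ξ η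
    change ⟪(Θ ξ : K), (η : K)⟫ = ⟪(ξ : K), (Θ η : K)⟫
    rw [hΘ, hΘ, N.inner_starProjection_left_eq_right, hself,
      ← N.inner_starProjection_left_eq_right, hself]
    have := (hL _).1 (s η).2 _ (s ξ).2
    rw [hs1, hs1] at this
    exact this.symm
  refine ⟨⟨N.starProjection, isStarProjection_starProjection, Θ, hsymm⟩, ?_⟩
  ext ⟨a, c⟩
  rw [mem_relation]
  have key : ∀ ξ : (N.starProjection).range,
      (N.starProjection).rangeRestrict c = Θ ξ ↔ ((ξ : K), c) ∈ L := by
    intro ξ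
    have e1 : ((ξ : K), c) = (s ξ : K × K) + (0, c - (s ξ : K × K).2) :=
      Prod.ext (by simp [hs1]) (by simp)
    rw [e1, Submodule.add_mem_iff_right _ (s ξ).2, hmul,
      ← Submodule.starProjection_apply_eq_zero_iff, map_sub, sub_eq_zero, ← hΘ]
    exact Subtype.ext_iff
  constructor
  · rintro ⟨ξ, rfl, h⟩
    exact (key ξ).1 h
  · intro h
    exact ⟨⟨a, hrange.ge ⟨_, h, rfl⟩⟩, rfl, (key _).2 h⟩

end ExtParam

/-! ### The extensions given by a boundary triple -/

namespace BoundaryTriple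

variable {A : E →ₗ.[ℂ] E} {τ : E →ₗ.[ℂ] K} (b : BoundaryTriple A τ)

/-- The restriction of the maximal operator by the boundary condition `(jump u, τ u) ∈ L`. -/
def ofRelation (L : Submodule ℂ (K × K)) : E →ₗ.[ℂ] E where
  domain := (L.comap (b.jump.prod τ.toFun)).map τ.domain.subtype
  toFun := b.maxOp ∘ₗ Submodule.inclusion (Submodule.map_subtype_le _ _)

theorem mem_ofRelation {L : Submodule ℂ (K × K)} {x : E} :
    x ∈ (b.ofRelation L).domain ↔ ∃ h : x ∈ τ.domain, (b.jump ⟨x, h⟩, τ ⟨x, h⟩) ∈ L := by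
  constructor
  · rintro ⟨u, hu, rfl⟩
    exact ⟨u.2, hu⟩
  · rintro ⟨h, hu⟩
    exact ⟨⟨x, h⟩, hu, rfl⟩

theorem ofRelation_apply {L : Submodule ℂ (K × K)} (u : (b.ofRelation L).domain) :
    b.ofRelation L u = b.maxOp ⟨u, (b.mem_ofRelation.1 u.2).1⟩ := rfl

theorem mem_restrictKer {x : E} :
    x ∈ (restrictKer A τ).domain ↔
      ∃ h : x ∈ τ.domain, b.jump ⟨x, h⟩ = 0 ∧ τ ⟨x, h⟩ = 0 := by
  constructor
  · rintro ⟨⟨u, hu, rfl⟩, h⟩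
    exact ⟨u.2, (b.mem_domain_iff u).1 h, hu⟩
  · rintro ⟨h, h1, h2⟩
    exact ⟨⟨⟨x, h⟩, h2, rfl⟩, (b.mem_domain_iff ⟨x, h⟩).2 h1⟩

theorem restrictKer_apply (u : (restrictKer A τ).domain) :
    restrictKer A τ u = b.maxOp ⟨u, (b.mem_restrictKer.1 u.2).1⟩ := by
  rw [← b.apply_eq ⟨u, u.2.2⟩]
  exact LinearPMap.domRestrict_apply rfl

theorem restrictKer_le_ofRelation (L : Submodule ℂ (K × K)) :
    restrictKer A τ ≤ b.ofRelation L := by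
  refine ⟨fun x hx => ?_, ?_⟩
  · obtain ⟨h, h1, h2⟩ := b.mem_restrictKer.1 hx
    exact b.mem_ofRelation.2 ⟨h, by rw [h1, h2]; exact L.zero_mem⟩
  · rintro u v huv
    rw [b.restrictKer_apply, b.ofRelation_apply]
    congr 2

variable [CompleteSpace E] [FiniteDimensional ℂ K] [CompleteSpace K]

include b in
/-- The domain of `S` is dense: a vector `w` orthogonal to it solves the adjoint equation for `x = 0`,
so that `w = T 0 = 0`. -/
theorem dense_restrictKer : Dense ((restrictKer A τ).domain : Set E) := by
  rw [Submodule.dense_iff_topologicalClosure_eq_top, Submodule.topologicalClosure_eq_top_iff,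
    Submodule.eq_bot_iff]
  intro w hw
  rw [Submodule.mem_orthogonal'] at hw
  obtain ⟨h0, h1⟩ := b.mem_of_inner_minimal 0 w fun u hu => by
    rw [inner_zero_left, hw u]
    exact b.mem_restrictKer.2 ⟨b.domain_le u.2, (b.mem_domain_iff ⟨u, _⟩).1 u.2, hu⟩
  rw [← h1]
  exact b.maxOp.map_zero

theorem mem_of_inner_restrictKer (x w : E)
    (h : ∀ u : (restrictKer A τ).domain, ⟪x, restrictKer A τ u⟫ = ⟪w, (u : E)⟫) :
    ∃ hx : x ∈ τ.domain, b.maxOp ⟨x, hx⟩ = w := by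
  refine b.mem_of_inner_minimal x w fun u hu => ?_
  have := h ⟨u, b.mem_restrictKer.2 ⟨b.domain_le u.2, (b.mem_domain_iff ⟨u, _⟩).1 u.2, hu⟩⟩
  rwa [b.restrictKer_apply, ← b.apply_eq] at this

theorem isSelfAdjoint_ofRelation {L : Submodule ℂ (K × K)} (hL : IsLagrangian L) :
    IsSelfAdjoint (b.ofRelation L) := by
  have hS := b.restrictKer_le_ofRelation L
  refine isSelfAdjoint_of_adjoint_le (b.dense_restrictKer.mono hS.1) (fun u v => ?_)
    fun x w hx => ?_
  · obtain ⟨hu, hu'⟩ := b.mem_ofRelation.1 u.2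
    obtain ⟨hv, hv'⟩ := b.mem_ofRelation.1 v.2
    have hg := b.green ⟨u, hu⟩ ⟨v, hv⟩
    rw [(hL _).1 hv' _ hu', sub_self] at hg
    exact sub_eq_zero.1 hg
  · obtain ⟨hxτ, hw⟩ := b.mem_of_inner_restrictKer x w fun u => by
      have h1 := hx ⟨u, hS.1 u.2⟩
      rwa [← hS.2 (x := u) rfl] at h1
    refine b.mem_ofRelation.2 ⟨hxτ, (hL _).2 fun r hr => ?_⟩
    obtain ⟨u, hu1, hu2⟩ := b.exists_jump_trace r.1 r.2
    have hu : (u : E) ∈ (b.ofRelation L).domain :=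
      b.mem_ofRelation.2 ⟨u.2, by rw [hu1, hu2]; exact hr⟩
    have hg := b.green u ⟨x, hxτ⟩
    have h2 : ⟪b.maxOp u, x⟫ = ⟪(u : E), w⟫ := by
      rw [← inner_conj_symm, ← inner_conj_symm (u : E) w]
      exact congrArg (starRingEnd ℂ) (hx ⟨u, hu⟩)
    rw [hw, hu1, hu2] at hg
    dsimp only at hg ⊢
    rw [h2, sub_self] at hg
    exact sub_eq_zero.1 hg.symm

theorem ofRelation_injective : Function.Injective b.ofRelation := by
  have key : ∀ L L' : Submodule ℂ (K × K), b.ofRelation L = b.ofRelation L' → L ≤ L' := by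
    rintro L L' h ⟨r1, r2⟩ hr
    obtain ⟨u, rfl, rfl⟩ := b.exists_jump_trace r1 r2
    have hu : (u : E) ∈ (b.ofRelation L).domain := b.mem_ofRelation.2 ⟨u.2, hr⟩
    rw [h] at hu
    exact (b.mem_ofRelation.1 hu).2
  exact fun L L' h => le_antisymm (key _ _ h) (key _ _ h.symm)

/-- Every self-adjoint extension `B` of `S` is the restriction of the maximal operator by the
Lagrangian boundary condition `L = {(jump u, τ u) : u ∈ dom B}`. -/
theorem exists_ofRelation_eq {B : E →ₗ.[ℂ] E} (hB : IsSelfAdjoint B) (hS : restrictKer A τ ≤ B) :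
    ∃ L : Submodule ℂ (K × K), IsLagrangian L ∧ b.ofRelation L = B := by
  have hmax : ∀ u : B.domain, ∃ hu : (u : E) ∈ τ.domain, b.maxOp ⟨u, hu⟩ = B u := by
    intro u
    refine b.mem_of_inner_restrictKer u (B u) fun v => ?_
    rw [hS.2 (x := v) (y := ⟨v, hS.1 v.2⟩) rfl]
    exact (inner_apply_eq_of_isSelfAdjoint hB u ⟨v, hS.1 v.2⟩).symm
  have hle : B.domain ≤ τ.domain := fun x hx => (hmax ⟨x, hx⟩).1
  set L : Submodule ℂ (K × K) := (B.domain.comap τ.domain.subtype).map (b.jump.prod τ.toFun)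
    with hLdef
  have hmem : ∀ u : τ.domain, (b.jump u, τ u) ∈ L ↔ (u : E) ∈ B.domain := by
    intro u
    constructor
    · rintro ⟨v, hv, e⟩
      have e1 : b.jump v = b.jump u := congrArg Prod.fst e
      have e2 : τ v = τ u := congrArg Prod.snd e
      have h0 : ((u - v : τ.domain) : E) ∈ (restrictKer A τ).domain :=
        b.mem_restrictKer.2 ⟨(u - v).2, by rw [Subtype.coe_eta, map_sub, e1, sub_self], by
          rw [Subtype.coe_eta, LinearPMap.map_sub, e2, sub_self]⟩
      have h1 := B.domain.add_mem (hS.1 h0) hv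
      simpa using h1
    · exact fun hu => ⟨u, hu, rfl⟩
  refine ⟨L, ?_, ?_⟩
  · rintro ⟨q1, q2⟩
    obtain ⟨x, rfl, rfl⟩ := b.exists_jump_trace q1 q2
    rw [hmem]
    constructor
    · rintro hx _ ⟨u, hu, rfl⟩
      have hg := b.green u x
      have h1 := inner_apply_eq_of_isSelfAdjoint hB ⟨u, hu⟩ ⟨x, hx⟩
      obtain ⟨_, e1⟩ := hmax ⟨u, hu⟩
      obtain ⟨_, e2⟩ := hmax ⟨x, hx⟩
      rw [← e1, ← e2] at h1
      rw [sub_eq_zero.2 h1] at hg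
      exact sub_eq_zero.1 hg.symm
    · intro h
      refine mem_domain_of_isSelfAdjoint hB (w := b.maxOp x) fun u => ?_
      obtain ⟨hu, e⟩ := hmax u
      have h1 := h _ ((hmem ⟨u, hu⟩).2 u.2)
      have hg := b.green ⟨u, hu⟩ x
      dsimp only at h1 hg
      rw [h1, sub_self, e] at hg
      rw [← inner_conj_symm, sub_eq_zero.1 hg, inner_conj_symm]
  · refine LinearPMap.ext (Submodule.ext fun x => ?_) fun x hx hx' => ?_
    · rw [b.mem_ofRelation]
      constructor
      · rintro ⟨h, h1⟩
        exact (hmem ⟨x, h⟩).1 h1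
      · exact fun hx => ⟨hle hx, (hmem ⟨x, hle hx⟩).2 hx⟩
    · exact (hmax ⟨x, hx'⟩).2

/-- The bijection from couples `(Π, Θ)` to self-adjoint extensions. -/
def extEquiv : ExtParam K ≃ SelfAdjointExt (restrictKer A τ) :=
  Equiv.ofBijective
    (fun p => ⟨b.ofRelation p.relation, b.isSelfAdjoint_ofRelation p.isLagrangian_relation,
      b.restrictKer_le_ofRelation _⟩) <| by
    refine ⟨fun p q h => ?_, ?_⟩
    · exact ExtParam.relation_injective (b.ofRelation_injective (congrArg Subtype.val h))
    · rintro ⟨B, hB, hS⟩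
      obtain ⟨L, hL, rfl⟩ := b.exists_ofRelation_eq hB hS
      obtain ⟨p, rfl⟩ := ExtParam.exists_relation_eq hL
      exact ⟨p, rfl⟩

theorem extEquiv_apply (p : ExtParam K) : (b.extEquiv p).1 = b.ofRelation p.relation := rfl

section Extension

variable (p : ExtParam K)

theorem mem_extEquiv {x : E} : x ∈ (b.extEquiv p).1.domain ↔
    ∃ (h : x ∈ τ.domain) (ξ : p.proj.range), (ξ : K) = b.jump ⟨x, h⟩ ∧
      p.proj.rangeRestrict (τ ⟨x, h⟩) = p.op ξ := by
  rw [extEquiv_apply, b.mem_ofRelation]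
  simp only [p.mem_relation]

theorem jump_of_eq_add {z : ℂ} (hz : z ∈ resSet A) {x x₀ : E} (hx : x ∈ τ.domain)
    (h₀ : x₀ ∈ A.domain) {ξ : K} (e : x = x₀ + gField A τ z ξ) : b.jump ⟨x, hx⟩ = ξ := by
  have e' : (⟨x, hx⟩ : τ.domain) = ⟨x₀, b.domain_le h₀⟩ + ⟨_, b.gField_mem hz ξ⟩ :=
    Subtype.ext e
  rw [e', map_add, b.jump_gField hz, (b.mem_domain_iff ⟨x₀, b.domain_le h₀⟩).1 h₀, zero_add]

theorem sub_gField_mem {z : ℂ} (hz : z ∈ resSet A) (u : τ.domain) :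
    (u : E) - gField A τ z (b.jump u) ∈ A.domain := by
  have : ((u - ⟨_, b.gField_mem hz (b.jump u)⟩ : τ.domain) : E) ∈ A.domain := by
    rw [b.mem_domain_iff, map_sub, b.jump_gField hz, sub_self]
  exact this

theorem mem_extEquiv_iff {z : ℂ} (hz : z ∈ resSet A) (x : E) :
    x ∈ (b.extEquiv p).1.domain ↔ ∃ x₀ ∈ A.domain, ∃ ξ : p.proj.range,
      x = x₀ + gField A τ z ξ ∧
        ∃ h : x ∈ τ.domain, p.proj.rangeRestrict (τ ⟨x, h⟩) = p.op ξ := by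
  rw [b.mem_extEquiv]
  constructor
  · rintro ⟨h, ξ, h1, h2⟩
    refine ⟨x - gField A τ z ξ, ?_, ξ, by abel, h, h2⟩
    rw [h1]
    exact b.sub_gField_mem hz ⟨x, h⟩
  · rintro ⟨x₀, h₀, ξ, e, h, h2⟩
    exact ⟨h, ξ, (b.jump_of_eq_add hz h h₀ e).symm, h2⟩

theorem extEquiv_apply_of_eq_add {z : ℂ} (hz : z ∈ resSet A) (u : (b.extEquiv p).1.domain)
    (u₀ : A.domain) (ξ : K) (e : (u : E) = u₀ + gField A τ z ξ) :
    -(b.extEquiv p).1 u + z • (u : E) = -A u₀ + z • (u₀ : E) := by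
  have hu : (u : E) ∈ τ.domain := ((b.mem_extEquiv p).1 u.2).1
  have e' : (⟨u, hu⟩ : τ.domain) = ⟨u₀, b.domain_le u₀.2⟩ + ⟨_, b.gField_mem hz ξ⟩ :=
    Subtype.ext e
  have e2 : (b.extEquiv p).1 u = b.maxOp ⟨u, hu⟩ := rfl
  rw [e2, e', map_add, ← b.apply_eq, b.maxOp_gField hz, e, smul_add]
  abel

theorem exists_unique_decomposition (x : E) (hx : x ∈ (b.extEquiv p).1.domain) :
    ∃ ξ : p.proj.range, ∀ z ∈ resSet A, x - gField A τ z ξ ∈ A.domain ∧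
      ∀ x₀ ∈ A.domain, ∀ η : p.proj.range, x = x₀ + gField A τ z η →
        η = ξ ∧ x₀ = x - gField A τ z ξ := by
  obtain ⟨h, ξ, h1, -⟩ := (b.mem_extEquiv p).1 hx
  refine ⟨ξ, fun z hz => ⟨?_, fun x₀ h₀ η e => ?_⟩⟩
  · rw [h1]
    exact b.sub_gField_mem hz ⟨x, h⟩
  · have e1 : η = ξ := Subtype.ext ((b.jump_of_eq_add hz h h₀ e).symm.trans h1.symm)
    subst e1
    exact ⟨rfl, by rw [e]; abel⟩

theorem kreinGamma_apply {z : ℂ} (hz : z ∈ resSet A) (ξ : p.proj.range) :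
    kreinGamma A τ p z ξ = p.op ξ - p.proj.rangeRestrict (τ ⟨_, b.gField_mem hz ξ⟩) := by
  rw [← b.comp_gField_apply hz]
  rfl

/-- A vector `ξ` in the kernel of `Θ - Π τ G_z Π` yields the eigenvector `G_z ξ` of the extension,
so that there is none for `z` in the resolvent set. -/
theorem isUnit_kreinGamma {z : ℂ} (hz' : z ∈ resSet (b.extEquiv p).1) (hz : z ∈ resSet A) :
    IsUnit (kreinGamma A τ p z) := by
  rw [LinearMap.isUnit_iff_ker_eq_bot, LinearMap.ker_eq_bot']
  intro ξ hξ
  rw [b.kreinGamma_apply p hz, sub_eq_zero] at hξ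
  have hm : gField A τ z ξ ∈ (b.extEquiv p).1.domain :=
    (b.mem_extEquiv_iff p hz _).2 ⟨0, A.domain.zero_mem, ξ, by rw [zero_add],
      b.gField_mem hz ξ, hξ.symm⟩
  have h1 := b.extEquiv_apply_of_eq_add p hz ⟨_, hm⟩ 0 ξ (by simp)
  have h2 := res_apply_eq hz' ⟨_, hm⟩
  rw [h1] at h2
  simp only [LinearPMap.map_zero, neg_zero, ZeroMemClass.coe_zero, smul_zero, add_zero,
    map_zero] at h2
  exact Subtype.ext (b.gField_injective hz (by rw [← h2]; simp))

/-- Kreĭn's resolvent formula. -/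
theorem res_extEquiv {z : ℂ} (hz' : z ∈ resSet (b.extEquiv p).1) (hz : z ∈ resSet A) (f : E) :
    res (b.extEquiv p).1 z f = res A z f + gField A τ z (Ring.inverse (kreinGamma A τ p z)
      (p.proj.rangeRestrict (ContinuousLinearMap.adjoint
        (gField A τ (starRingEnd ℂ z)) f))) := by
  have hm := res_mem hz' f
  obtain ⟨x₀, h₀, ξ, e, h, h2⟩ := (b.mem_extEquiv_iff p hz _).1 hm
  have h1 := b.extEquiv_apply_of_eq_add p hz ⟨_, hm⟩ ⟨x₀, h₀⟩ ξ e
  have hf : -(b.extEquiv p).1 ⟨_, hm⟩ + z • res (b.extEquiv p).1 z f = f :=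
    ((isResolventAt_res hz').1 f).2
  have hx₀ : res A z f = x₀ := by
    have h3 := res_apply_eq hz ⟨x₀, h₀⟩
    rwa [← h1, hf] at h3
  have hξ : kreinGamma A τ p z ξ = p.proj.rangeRestrict (ContinuousLinearMap.adjoint
      (gField A τ (starRingEnd ℂ z)) f) := by
    have e' : (⟨_, h⟩ : τ.domain) = ⟨x₀, b.domain_le h₀⟩ + ⟨_, b.gField_mem hz ξ⟩ :=
      Subtype.ext e
    rw [b.kreinGamma_apply p hz, ← h2, e', LinearPMap.map_add, map_add, add_sub_cancel_right,
      gField, Complex.conj_conj, ContinuousLinearMap.adjoint_adjoint, b.comp_res_apply hz]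
    simp only [hx₀]
  rw [← hξ, ← Module.End.mul_apply, Ring.inverse_mul_cancel _ (b.isUnit_kreinGamma p hz' hz),
    Module.End.one_apply, hx₀]
  exact e

end Extension

end BoundaryTriple

end Extensions

section Green

/-! ### Integration by parts on `ℝ ∖ Y` -/

section OneSidedValues

variable {V : Type*} [NormedAddCommGroup V]

theorem intervalIntegrable_L2 (f : L2 V) (a b : ℝ) : IntervalIntegrable f volume a b :=
  ((locallyIntegrable_L2 f).integrableOn_isCompact isCompact_uIcc).intervalIntegrable

theorem leftValue_eq {f : L2 V} {F : ℝ → V} (hF : Continuous F) {a b x : ℝ}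
    (h : ∀ᵐ t ∂volume, t ∈ Set.Ioo a b → f t = F t) (hx : x ∈ Set.Ioc a b) :
    leftValue f x = F x := by
  have := neBot_left x
  refine Tendsto.limUnder_eq (((hF.tendsto x).mono_left
    (inf_le_left.trans nhdsWithin_le_nhds)).congr' ?_)
  filter_upwards [mem_inf_of_left (Ioo_mem_nhdsLT hx.1), mem_inf_of_right h] with t h1 h2
  exact (h2 ⟨h1.1, h1.2.trans_le hx.2⟩).symm

theorem rightValue_eq {f : L2 V} {F : ℝ → V} (hF : Continuous F) {a b x : ℝ}
    (h : ∀ᵐ t ∂volume, t ∈ Set.Ioo a b → f t = F t) (hx : x ∈ Set.Ico a b) :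
    rightValue f x = F x := by
  have := neBot_right x
  refine Tendsto.limUnder_eq (((hF.tendsto x).mono_left
    (inf_le_left.trans nhdsWithin_le_nhds)).congr' ?_)
  filter_upwards [mem_inf_of_left (Ioo_mem_nhdsGT hx.2), mem_inf_of_right h] with t h1 h2
  exact (h2 ⟨hx.1.trans_lt h1.1, h1.2⟩).symm

end OneSidedValues

section Inner

variable {V : Type*} [NormedAddCommGroup V] [InnerProductSpace ℂ V]

theorem integrable_inner_L2 (f g : L2 V) : Integrable (fun x => ⟪f x, g x⟫) :=
  L2.integrable_inner (𝕜 := ℂ) f g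

theorem integrable_inner_prod {μ ν : Measure ℝ} {u v : ℝ → V}
    (hu : Integrable u μ) (hv : Integrable v ν) :
    Integrable (fun p : ℝ × ℝ => ⟪u p.1, v p.2⟫) (μ.prod ν) :=
  hu.op_fst_snd (op := fun x y => ⟪x, y⟫) continuous_inner
    ⟨1, fun x y => by rw [one_mul]; exact norm_inner_le_norm x y⟩ hv

theorem continuous_primitive_L2 (g : L2 V) (c : V) (a : ℝ) :
    Continuous fun x => c + ∫ t in a..x, g t :=
  continuous_const.add (intervalIntegral.continuous_primitive (intervalIntegrable_L2 g) a)

end Inner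

variable {V : Type*} [NormedAddCommGroup V] [InnerProductSpace ℂ V] [CompleteSpace V]

theorem integral_inner_const {μ : Measure ℝ} {u : ℝ → V} (hu : Integrable u μ) (c : V) :
    ∫ x, ⟪u x, c⟫ ∂μ = ⟪∫ x, u x ∂μ, c⟫ := by
  rw [← inner_conj_symm, ← integral_inner hu, ← integral_conj]
  simp only [inner_conj_symm]

/-- Integration by parts for two primitives: by Fubini, the two integrals are those of
`⟪u x, v t⟫` over the two halves of a square. -/
theorem integral_inner_primitive {a b : ℝ} {u v : ℝ → V}
    (hu : IntegrableOn u (Set.Ioc a b)) (hv : IntegrableOn v (Set.Ioc a b)) :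
    (∫ x in Set.Ioc a b, ⟪u x, ∫ t in a..x, v t⟫) + ∫ x in Set.Ioc a b, ⟪∫ t in a..x, u t, v x⟫
      = ⟪∫ x in Set.Ioc a b, u x, ∫ x in Set.Ioc a b, v x⟫ := by
  set μ := volume.restrict (Set.Ioc a b) with hμ
  have hF := integrable_inner_prod hu hv
  have hm : MeasurableSet {p : ℝ × ℝ | p.2 ≤ p.1} := measurableSet_le measurable_snd measurable_fst
  have e1 : ∫ x, ⟪u x, ∫ t in a..x, v t⟫ ∂μ
      = ∫ p in {p : ℝ × ℝ | p.2 ≤ p.1}, ⟪u p.1, v p.2⟫ ∂(μ.prod μ) := by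
    rw [← integral_indicator hm, integral_prod _ (hF.indicator hm)]
    refine integral_congr_ae ?_
    filter_upwards [ae_restrict_mem measurableSet_Ioc] with x hx
    have e : ∫ t in a..x, v t = ∫ t, (Set.Iic x).indicator v t ∂μ := by
      rw [integral_indicator measurableSet_Iic, Measure.restrict_restrict measurableSet_Iic,
        intervalIntegral.integral_of_le hx.1.le]
      congr 2
      ext t
      exact ⟨fun h => ⟨h.2, h.1, h.2.trans hx.2⟩, fun h => ⟨h.2.1, h.1⟩⟩
    rw [e, ← integral_inner (hv.indicator measurableSet_Iic)]
    refine integral_congr_ae (Eventually.of_forall fun t => ?_)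
    by_cases h : t ≤ x <;> simp [Set.indicator, h]
  have e2 : ∫ x, ⟪∫ t in a..x, u t, v x⟫ ∂μ
      = ∫ p in {p : ℝ × ℝ | p.2 ≤ p.1}ᶜ, ⟪u p.1, v p.2⟫ ∂(μ.prod μ) := by
    rw [← integral_indicator hm.compl, integral_prod_symm _ (hF.indicator hm.compl)]
    refine integral_congr_ae ?_
    filter_upwards [ae_restrict_mem measurableSet_Ioc] with x hx
    have e : ∫ t in a..x, u t = ∫ t, (Set.Iio x).indicator u t ∂μ := by
      rw [integral_indicator measurableSet_Iio, Measure.restrict_restrict measurableSet_Iio,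
        intervalIntegral.integral_of_le hx.1.le, integral_Ioc_eq_integral_Ioo]
      congr 2
      ext t
      exact ⟨fun h => ⟨h.2, h.1, h.2.le.trans hx.2⟩, fun h => ⟨h.2.1, h.1⟩⟩
    rw [e, ← integral_inner_const (hu.indicator measurableSet_Iio)]
    refine integral_congr_ae (Eventually.of_forall fun t => ?_)
    by_cases h : t < x
    · simp [Set.indicator, h]
    · simp [Set.indicator, h, not_lt.1 h]
  rw [e1, e2, integral_add_compl hm hF, integral_prod _ hF, ← integral_inner_const hu]
  simp_rw [integral_inner hv]
  rfl

/-- A function in `H¹(ℝ ∖ Y)` agrees almost everywhere with its one-sided limits. It does so on each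
of the countably many intervals with rational end points that do not meet `Y`. -/
theorem HasWeakDeriv.ae_eq_values {Y : Finset ℝ} {f f' : L2 V} (hf : HasWeakDeriv Y f f') :
    ∀ᵐ x ∂volume, leftValue f x = f x ∧ rightValue f x = f x := by
  have h1 : ∀ q r : ℚ, ∀ᵐ x ∂volume, Disjoint (Set.Ioo (q : ℝ) r) (Y : Set ℝ) →
      x ∈ Set.Ioo (q : ℝ) r → leftValue f x = f x ∧ rightValue f x = f x := by
    intro q r
    by_cases hd : Disjoint (Set.Ioo (q : ℝ) r) (Y : Set ℝ)
    · by_cases hqr : (q : ℝ) < r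
      · obtain ⟨c, hc⟩ := hf.exists_eq_primitive hqr hd
        filter_upwards [hc] with x hx _ hm
        have hF := continuous_primitive_L2 f' c q
        rw [hx hm]
        exact ⟨leftValue_eq hF hc ⟨hm.1, hm.2.le⟩, rightValue_eq hF hc ⟨hm.1.le, hm.2⟩⟩
      · exact Eventually.of_forall fun x _ hm => absurd (hm.1.trans hm.2) hqr
    · exact Eventually.of_forall fun x hd' => absurd hd' hd
  have hn : ∀ᵐ x ∂(volume : Measure ℝ), x ∈ ((Y : Set ℝ)ᶜ) :=
    measure_eq_zero_iff_ae_notMem.1 (Y.finite_toSet.measure_zero volume)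
  filter_upwards [ae_all_iff.2 fun q => ae_all_iff.2 (h1 q), hn] with x hx hxY
  have hU : (Y : Set ℝ)ᶜ ∈ 𝓝 x := Y.finite_toSet.isClosed.isOpen_compl.mem_nhds hxY
  obtain ⟨l, r, hlr, hs⟩ := mem_nhds_iff_exists_Ioo_subset.1 hU
  obtain ⟨q, hq1, hq2⟩ := exists_rat_btwn hlr.1
  obtain ⟨s, hs1, hs2⟩ := exists_rat_btwn hlr.2
  refine hx q s (Set.disjoint_left.2 fun t ht => hs ⟨hq1.trans ht.1, ht.2.trans hs2⟩) ⟨hq2, hs1⟩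

section GreenIdentity

variable {Y : Finset ℝ} {f f' g g' : L2 V}

/-- Integration by parts on an interval without points of `Y`. -/
theorem HasWeakDeriv.integral_inner_Ioo (hf : HasWeakDeriv Y f f') (hg : HasWeakDeriv Y g g')
    {a b : ℝ} (hab : a < b) (hd : Disjoint (Set.Ioo a b) (Y : Set ℝ)) :
    ∫ x in a..b, (⟪f' x, g x⟫ + ⟪f x, g' x⟫)
      = ⟪leftValue f b, leftValue g b⟫ - ⟪rightValue f a, rightValue g a⟫ := by
  obtain ⟨c, hc⟩ := hf.exists_eq_primitive hab hd
  obtain ⟨d, hd⟩ := hg.exists_eq_primitive hab hd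
  have hF := continuous_primitive_L2 f' c a
  have hG := continuous_primitive_L2 g' d a
  have hu : IntegrableOn f' (Set.Ioc a b) := (intervalIntegrable_L2 f' a b).1
  have hv : IntegrableOn g' (Set.Ioc a b) := (intervalIntegrable_L2 g' a b).1
  rw [leftValue_eq hF hc ⟨hab, le_rfl⟩, leftValue_eq hG hd ⟨hab, le_rfl⟩,
    rightValue_eq hF hc ⟨le_rfl, hab⟩, rightValue_eq hG hd ⟨le_rfl, hab⟩]
  simp only [intervalIntegral.integral_same, add_zero]
  rw [intervalIntegral.integral_of_le hab.le, intervalIntegral.integral_of_le hab.le,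
    intervalIntegral.integral_of_le hab.le]
  have hmem : ∀ᵐ x ∂volume.restrict (Set.Ioc a b), x ∈ Set.Ioo a b := by
    rw [← Measure.restrict_congr_set (Ioo_ae_eq_Ioc (a := a) (b := b) (μ := volume))]
    exact ae_restrict_mem measurableSet_Ioo
  have i1 : IntegrableOn (fun x => ⟪f' x, d + ∫ t in a..x, g' t⟫) (Set.Ioc a b) := by
    refine (integrable_inner_L2 f' g).integrableOn.congr ?_
    filter_upwards [hmem, ae_restrict_of_ae hd] with x h1 h2
    rw [h2 h1]
  have i2 : IntegrableOn (fun x => ⟪c + ∫ t in a..x, f' t, g' x⟫) (Set.Ioc a b) := by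
    refine (integrable_inner_L2 f g').integrableOn.congr ?_
    filter_upwards [hmem, ae_restrict_of_ae hc] with x h1 h2
    rw [h2 h1]
  have i3 : IntegrableOn (fun x => ⟪f' x, d⟫) (Set.Ioc a b) := hu.inner_const d
  have i4 : IntegrableOn (fun x => ⟪c, g' x⟫) (Set.Ioc a b) := hv.const_inner c
  have i5 : IntegrableOn (fun x => ⟪f' x, ∫ t in a..x, g' t⟫) (Set.Ioc a b) := by
    refine (i1.sub i3).congr (Eventually.of_forall fun x => ?_)
    simp
  have i6 : IntegrableOn (fun x => ⟪∫ t in a..x, f' t, g' x⟫) (Set.Ioc a b) := by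
    refine (i2.sub i4).congr (Eventually.of_forall fun x => ?_)
    simp
  have key : ∫ x in Set.Ioc a b, (⟪f' x, g x⟫ + ⟪f x, g' x⟫)
      = ∫ x in Set.Ioc a b, ((⟪f' x, d⟫ + ⟪f' x, ∫ t in a..x, g' t⟫)
        + (⟪c, g' x⟫ + ⟪∫ t in a..x, f' t, g' x⟫)) := by
    refine integral_congr_ae ?_
    filter_upwards [hmem, ae_restrict_of_ae hc, ae_restrict_of_ae hd] with x h1 h2 h3
    rw [h2 h1, h3 h1, inner_add_left, inner_add_right]
  have i7 : IntegrableOn (fun x => ⟪f' x, d⟫ + ⟪f' x, ∫ t in a..x, g' t⟫) (Set.Ioc a b) :=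
    i3.add i5
  have i8 : IntegrableOn (fun x => ⟪c, g' x⟫ + ⟪∫ t in a..x, f' t, g' x⟫) (Set.Ioc a b) :=
    i4.add i6
  rw [key, integral_add i7 i8, integral_add i3 i5, integral_add i4 i6,
    integral_inner_const hu, integral_inner hv, inner_add_left, inner_add_right, inner_add_right,
    ← integral_inner_primitive hu hv]
  ring

/-- The jump of `⟪f, g⟫` at `y`. -/
def innerJump (f g : L2 V) (y : ℝ) : ℂ :=
  ⟪rightValue f y, rightValue g y⟫ - ⟪leftValue f y, leftValue g y⟫

theorem HasWeakDeriv.integral_inner_interval (hf : HasWeakDeriv Y f f')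
    (hg : HasWeakDeriv Y g g') {a b : ℝ} (hab : a < b) :
    ∫ x in a..b, (⟪f' x, g x⟫ + ⟪f x, g' x⟫)
      = ⟪leftValue f b, leftValue g b⟫ - ⟪rightValue f a, rightValue g a⟫
        - ∑ y ∈ Y with y ∈ Set.Ioo a b, innerJump f g y := by
  classical
  have hi : ∀ a b, IntervalIntegrable (fun x => ⟪f' x, g x⟫ + ⟪f x, g' x⟫) volume a b :=
    fun a b => ((integrable_inner_L2 f' g).add (integrable_inner_L2 f g')).intervalIntegrable
  induction hN : (Y.filter (· ∈ Set.Ioo a b)).card using Nat.strong_induction_on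
    generalizing a b with
  | _ N ih =>
    by_cases hd : Disjoint (Set.Ioo a b) (Y : Set ℝ)
    · rw [hf.integral_inner_Ioo hg hab hd, Finset.filter_eq_empty_iff.2, Finset.sum_empty,
        sub_zero]
      exact fun y hy h => Set.disjoint_left.1 hd h hy
    · obtain ⟨y, hy, hyY⟩ := Set.not_disjoint_iff.1 hd
      have hsplit : Y.filter (· ∈ Set.Ioo a b)
          = insert y (Y.filter (· ∈ Set.Ioo a y) ∪ Y.filter (· ∈ Set.Ioo y b)) := by
        ext t
        simp only [Finset.mem_filter, Finset.mem_insert, Finset.mem_union, Set.mem_Ioo]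
        constructor
        · rintro ⟨h1, h2, h3⟩
          rcases lt_trichotomy t y with h | h | h
          · exact Or.inr (Or.inl ⟨h1, h2, h⟩)
          · exact Or.inl h
          · exact Or.inr (Or.inr ⟨h1, h, h3⟩)
        · rintro (h | ⟨h1, h2, h3⟩ | ⟨h1, h2, h3⟩)
          · subst h; exact ⟨hyY, hy.1, hy.2⟩
          · exact ⟨h1, h2, h3.trans hy.2⟩
          · exact ⟨h1, hy.1.trans h2, h3⟩
      have hyn : y ∉ Y.filter (· ∈ Set.Ioo a y) ∪ Y.filter (· ∈ Set.Ioo y b) := by simp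
      have hdis : Disjoint (Y.filter (· ∈ Set.Ioo a y)) (Y.filter (· ∈ Set.Ioo y b)) := by
        refine Finset.disjoint_left.2 fun t h1 h2 => ?_
        exact lt_asymm (Finset.mem_filter.1 h1).2.2 (Finset.mem_filter.1 h2).2.1
      have hcard := congrArg Finset.card hsplit
      rw [Finset.card_insert_of_notMem hyn, Finset.card_union_of_disjoint hdis] at hcard
      rw [← intervalIntegral.integral_add_adjacent_intervals (hi a y) (hi y b),
        ih _ (by omega) hy.1 rfl, ih _ (by omega) hy.2 rfl, hsplit, Finset.sum_insert hyn,
        Finset.sum_union hdis, innerJump]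
      ring

/-- **Green's identity** on `ℝ ∖ Y`. There are no boundary terms at infinity: they have limits
because `⟪f', g⟫ + ⟪f, g'⟫` is integrable, and these vanish because `⟪f, g⟫` is integrable. -/
theorem HasWeakDeriv.inner_add_inner (hf : HasWeakDeriv Y f f') (hg : HasWeakDeriv Y g g') :
    ⟪f', g⟫ + ⟪f, g'⟫ = - ∑ y ∈ Y, innerJump f g y := by
  classical
  set P : ℝ → ℂ := fun x => ⟪f' x, g x⟫ + ⟪f x, g' x⟫ with hP
  have hPi : Integrable P := (integrable_inner_L2 f' g).add (integrable_inner_L2 f g')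
  have hsum : ⟪f', g⟫ + ⟪f, g'⟫ = ∫ x, P x := by
    rw [L2.inner_def, L2.inner_def,
      ← integral_add (integrable_inner_L2 f' g) (integrable_inner_L2 f g')]
  obtain ⟨M, hM0, hM⟩ : ∃ M : ℝ, 0 < M ∧ ∀ y ∈ Y, y ∈ Set.Ioo (-M) M := by
    obtain ⟨r, hr⟩ := Y.finite_toSet.isBounded.subset_ball (0 : ℝ)
    refine ⟨max r 1, by positivity, fun y hy => ?_⟩
    have := hr hy
    rw [Real.ball_eq_Ioo, zero_sub, zero_add] at this
    exact ⟨by linarith [this.1, le_max_left r 1], this.2.trans_le (le_max_left r 1)⟩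
  have hfil : ∀ a b, a ≤ -M → M ≤ b → Y.filter (· ∈ Set.Ioo a b) = Y := by
    intro a b ha hb
    refine Finset.filter_true_of_mem fun y hy => ?_
    exact ⟨ha.trans_lt (hM y hy).1, (hM y hy).2.trans_le hb⟩
  set J := ∑ y ∈ Y, innerJump f g y with hJ
  have hae := hf.ae_eq_values
  have hae' := hg.ae_eq_values
  -- the boundary term at `+∞`
  set Q : ℝ → ℂ := fun x => ⟪leftValue f x, leftValue g x⟫ with hQ
  have hQi : Integrable Q := by
    refine (integrable_inner_L2 f g).congr ?_
    filter_upwards [hae, hae'] with x h1 h2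
    rw [hQ]; dsimp only; rw [h1.1, h2.1]
  have hQt : Tendsto Q atTop (𝓝 ((∫ x in Set.Ioi (-M), P x)
      + ⟪rightValue f (-M), rightValue g (-M)⟫ + J)) := by
    have h1 := intervalIntegral_tendsto_integral_Ioi (-M) hPi.integrableOn tendsto_id
    refine ((h1.add_const _).add_const _).congr' ?_
    filter_upwards [eventually_ge_atTop M] with x hx
    have h2 := hf.integral_inner_interval hg (show -M < x by linarith)
    rw [hfil _ _ le_rfl hx] at h2
    rw [id, h2, hQ, hJ]
    ring
  have hQ0 := (hQi.integrableAtFilter atTop).eq_zero_of_tendsto (fun s hs => by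
    obtain ⟨c, hc⟩ := mem_atTop_sets.1 hs
    exact measure_mono_top (fun x hx => hc x hx) (Real.volume_Ici (a := c))) hQt
  -- the boundary term at `-∞`
  set R : ℝ → ℂ := fun x => ⟪rightValue f x, rightValue g x⟫ with hR
  have hRi : Integrable R := by
    refine (integrable_inner_L2 f g).congr ?_
    filter_upwards [hae, hae'] with x h1 h2
    rw [hR]; dsimp only; rw [h1.2, h2.2]
  have hQR : Tendsto R atBot (𝓝 (0 - J - ∫ x, P x)) := by
    have h1 := intervalIntegral_tendsto_integral_Iic (-M) hPi.integrableOn tendsto_id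
    have h3 : (∫ x, P x) = (∫ x in Set.Iic (-M), P x) + ∫ x in Set.Ioi (-M), P x :=
      (intervalIntegral.integral_Iic_add_Ioi hPi.integrableOn hPi.integrableOn).symm
    have h4 : (0 : ℂ) - J - ∫ x, P x
        = ⟪rightValue f (-M), rightValue g (-M)⟫ - ∫ x in Set.Iic (-M), P x := by
      rw [h3]
      linear_combination -hQ0
    rw [h4]
    refine (h1.const_sub _).congr' ?_
    filter_upwards [eventually_lt_atBot (-M)] with x hx
    have h2 := hf.integral_inner_interval hg (show x < M by linarith)
    have h5 := hf.integral_inner_interval hg (show -M < M by linarith)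
    rw [hfil _ _ hx.le le_rfl] at h2
    rw [hfil _ _ le_rfl le_rfl] at h5
    have h6 := intervalIntegral.integral_add_adjacent_intervals (μ := volume) (f := P)
      (a := x) (b := -M) (c := M) hPi.intervalIntegrable hPi.intervalIntegrable
    rw [h2, h5] at h6
    rw [hR, id]
    linear_combination -h6
  have hR0 := (hRi.integrableAtFilter atBot).eq_zero_of_tendsto (fun s hs => by
    obtain ⟨c, hc⟩ := mem_atBot_sets.1 hs
    exact measure_mono_top (fun x hx => hc x hx) (Real.volume_Iic (a := c))) hQR
  rw [hsum]
  linear_combination -hR0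

end GreenIdentity

end Green

section Sobolev

theorem values_of_continuous {V : Type*} [NormedAddCommGroup V] {f : L2 V} {F : ℝ → V} (hF : Continuous F) (h : f =ᵐ[volume] F)
    (y : ℝ) : leftValue f y = F y ∧ rightValue f y = F y :=
  ⟨leftValue_eq hF (a := y - 1) (b := y) (h.mono fun _ h _ => h) ⟨by linarith, le_rfl⟩,
    rightValue_eq hF (a := y) (b := y + 1) (h.mono fun _ h _ => h) ⟨le_rfl, by linarith⟩⟩

variable {V : Type*} [NormedAddCommGroup V] [InnerProductSpace ℂ V]

/-! ### Weak derivatives as orthogonality to test functions -/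

theorem memLp_smul_const {φ : ℝ → ℝ} (hφ : Continuous φ) (hc : HasCompactSupport φ) (v : V) :
    MemLp (fun x => φ x • v) 2 (volume : Measure ℝ) :=
  (hφ.smul continuous_const).memLp_of_hasCompactSupport hc.smul_right

/-- The class in `L²(ℝ; V)` of `x ↦ φ x • v`. -/
def testL2 {φ : ℝ → ℝ} (hφ : Continuous φ) (hc : HasCompactSupport φ) (v : V) : L2 V :=
  (memLp_smul_const hφ hc v).toLp

theorem coeFn_testL2 {φ : ℝ → ℝ} (hφ : Continuous φ) (hc : HasCompactSupport φ) (v : V) :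
    testL2 hφ hc v =ᵐ[volume] fun x => φ x • v :=
  MemLp.coeFn_toLp _

variable [CompleteSpace V]

theorem inner_testL2 {φ : ℝ → ℝ} (hφ : Continuous φ) (hc : HasCompactSupport φ) (v : V)
    (f : L2 V) : ⟪testL2 hφ hc v, f⟫ = ⟪v, ∫ x, φ x • f x⟫ := by
  rw [L2.inner_def, ← integral_inner (integrable_test_smul hφ hc (locallyIntegrable_L2 f))]
  refine integral_congr_ae ?_
  filter_upwards [coeFn_testL2 hφ hc v] with x hx
  rw [hx, ← Complex.coe_smul, ← Complex.coe_smul, inner_smul_left, inner_smul_right,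
    Complex.conj_ofReal]

theorem continuous_deriv_test {φ : ℝ → ℝ} (hφ : ContDiff ℝ ∞ φ) : Continuous (deriv φ) :=
  hφ.continuous_deriv (by simp)

theorem hasWeakDeriv_iff {Y : Finset ℝ} {f g : L2 V} :
    HasWeakDeriv Y f g ↔ ∀ (φ : ℝ → ℝ) (hφ : ContDiff ℝ ∞ φ) (hc : HasCompactSupport φ),
      Disjoint (tsupport φ) (Y : Set ℝ) → ∀ v : V,
        ⟪testL2 (continuous_deriv_test hφ) hc.deriv v, f⟫ = -⟪testL2 hφ.continuous hc v, g⟫ := by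
  constructor
  · intro h φ hφ hc hd v
    rw [inner_testL2, inner_testL2, h φ hφ hc hd, inner_neg_right]
  · intro h φ hφ hc hd
    refine ext_inner_left ℂ fun v => ?_
    rw [inner_neg_right, ← inner_testL2 (continuous_deriv_test hφ) hc.deriv,
      ← inner_testL2 hφ.continuous hc, h φ hφ hc hd]

theorem hasWeakDeriv_testL2 (Y : Finset ℝ) {φ : ℝ → ℝ} (hφ : ContDiff ℝ ∞ φ)
    (hc : HasCompactSupport φ) (v : V) :
    HasWeakDeriv Y (testL2 hφ.continuous hc v)
      (testL2 (continuous_deriv_test hφ) hc.deriv v) := by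
  intro ψ hψ hψc _
  have e1 : ∫ x, deriv ψ x • (testL2 hφ.continuous hc v : L2 V) x
      = (∫ x, deriv ψ x * φ x) • v := by
    rw [← integral_smul_const]
    refine integral_congr_ae ?_
    filter_upwards [coeFn_testL2 hφ.continuous hc v] with x hx
    rw [hx, mul_smul]
  have e2 : ∫ x, ψ x • (testL2 (continuous_deriv_test hφ) hc.deriv v : L2 V) x
      = (∫ x, ψ x * deriv φ x) • v := by
    rw [← integral_smul_const]
    refine integral_congr_ae ?_
    filter_upwards [coeFn_testL2 (continuous_deriv_test hφ) hc.deriv v] with x hx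
    rw [hx, mul_smul]
  have hd := hψ.differentiable (by simp)
  have hd' := hφ.differentiable (by simp)
  rw [e1, e2, ← neg_smul, integral_mul_deriv_eq_deriv_mul_of_integrable
    (fun x _ => (hd x).hasDerivAt) (fun x _ => (hd' x).hasDerivAt), neg_neg]
  · exact (hψ.continuous.mul (continuous_deriv_test hφ)).integrable_of_hasCompactSupport
      hψc.mul_right
  · exact ((continuous_deriv_test hψ).mul hφ.continuous).integrable_of_hasCompactSupport
      hψc.deriv.mul_right
  · exact (hψ.continuous.mul hφ.continuous).integrable_of_hasCompactSupport hψc.mul_right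

omit [CompleteSpace V] in
theorem HasWeakDeriv.mono {Y : Finset ℝ} {f g : L2 V} (h : HasWeakDeriv ∅ f g) :
    HasWeakDeriv Y f g :=
  fun φ hφ hc _ => h φ hφ hc (by simp)

/-- Functions in `H¹(ℝ)` have no jumps. -/
theorem HasWeakDeriv.leftValue_eq_rightValue {f g : L2 V} (h : HasWeakDeriv ∅ f g) (y : ℝ) :
    leftValue f y = rightValue f y := by
  obtain ⟨c, hc⟩ := h.exists_eq_primitive (show y - 1 < y + 1 by linarith) (by simp)
  have hF := continuous_primitive_L2 g c (y - 1)
  rw [leftValue_eq hF hc ⟨by linarith, by linarith⟩,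
    rightValue_eq hF hc ⟨by linarith, by linarith⟩]

/-- A function in `H¹(ℝ ∖ Y)` without jumps is in `H¹(ℝ)`, by Green's identity for test
functions. -/
theorem HasWeakDeriv.of_jump_eq_zero {Y : Finset ℝ} {f g : L2 V} (h : HasWeakDeriv Y f g)
    (hj : ∀ y ∈ Y, leftValue f y = rightValue f y) : HasWeakDeriv ∅ f g := by
  refine hasWeakDeriv_iff.2 fun φ hφ hc _ v => ?_
  have hG := (hasWeakDeriv_testL2 Y hφ hc v).inner_add_inner h
  rw [Finset.sum_eq_zero, neg_zero] at hG
  · exact eq_neg_of_add_eq_zero_left hG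
  · intro y hy
    obtain ⟨h1, h2⟩ := values_of_continuous (hφ.continuous.smul continuous_const)
      (coeFn_testL2 hφ.continuous hc v) y
    rw [innerJump, h1, h2, hj y hy, sub_self]

/-- The equation `-a² u'' + u = f` on the line: `(u, a u')` is the projection of `(f, 0)` onto the
closed subspace of all pairs of that form in `L² × L²`. -/
theorem exists_second_order (a : ℝ) (ha : a ≠ 0) (f : L2 V) :
    ∃ u u' u'' : L2 V, HasWeakDeriv ∅ u u' ∧ HasWeakDeriv ∅ u' u'' ∧
      -((a : ℂ) ^ 2 • u'') + u = f := by
  have ha' : (a : ℂ) ≠ 0 := Complex.ofReal_ne_zero.2 ha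
  -- the pairs `(u, a u')` are the orthogonal complement of these
  set T : Set (WithLp 2 (L2 V × L2 V)) :=
    {p | ∃ (φ : ℝ → ℝ) (hφ : ContDiff ℝ ∞ φ) (hc : HasCompactSupport φ) (v : V),
      p = WithLp.toLp 2 ((a : ℂ) • testL2 (continuous_deriv_test hφ) hc.deriv v,
        testL2 hφ.continuous hc v)} with hT
  set G := (Submodule.span ℂ T)ᗮ with hG
  have hmem : ∀ p : WithLp 2 (L2 V × L2 V), p ∈ G ↔
      HasWeakDeriv ∅ p.fst ((a : ℂ)⁻¹ • p.snd) := by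
    intro p
    rw [hG, Submodule.mem_orthogonal, hasWeakDeriv_iff]
    have e : ∀ (φ : ℝ → ℝ) (hφ : ContDiff ℝ ∞ φ) (hc : HasCompactSupport φ) (v : V),
        ⟪WithLp.toLp 2 ((a : ℂ) • testL2 (continuous_deriv_test hφ) hc.deriv v,
          testL2 hφ.continuous hc v), p⟫ = 0 ↔
        ⟪testL2 (continuous_deriv_test hφ) hc.deriv v, p.fst⟫
          = -⟪testL2 hφ.continuous hc v, (a : ℂ)⁻¹ • p.snd⟫ := by
      intro φ hφ hc v
      rw [WithLp.prod_inner_apply]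
      simp only [inner_smul_left, inner_smul_right, Complex.conj_ofReal]
      change (a : ℂ) * ⟪testL2 (continuous_deriv_test hφ) hc.deriv v, p.fst⟫
        + ⟪testL2 hφ.continuous hc v, p.snd⟫ = 0 ↔ _
      constructor
      · intro h
        field_simp
        linear_combination h
      · intro h
        rw [h]
        field_simp
        ring
    constructor
    · intro h φ hφ hc _ v
      exact (e φ hφ hc v).1 (h _ (Submodule.subset_span ⟨φ, hφ, hc, v, rfl⟩))
    · intro h q hq
      induction hq using Submodule.span_induction with
      | mem q hq =>
        obtain ⟨φ, hφ, hc, v, rfl⟩ := hq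
        exact (e φ hφ hc v).2 (h φ hφ hc (by simp) v)
      | zero => exact inner_zero_left _
      | add q r _ _ hq hr => rw [inner_add_left, hq, hr, add_zero]
      | smul c q _ hq => rw [inner_smul_left, hq, mul_zero]
  have : CompleteSpace (L2 V) := inferInstance
  have : CompleteSpace (L2 V × L2 V) := inferInstance
  have : CompleteSpace (WithLp 2 (L2 V × L2 V)) := inferInstance
  have : CompleteSpace G := (Submodule.isClosed_orthogonal _).completeSpace_coe
  have : G.HasOrthogonalProjection := .ofCompleteSpace G
  obtain ⟨p, hp, q, hq, hpq⟩ := G.exists_add_mem_mem_orthogonal (WithLp.toLp 2 (f, (0 : L2 V)))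
  have h1 : f = p.fst + q.fst := congrArg (fun r => (WithLp.ofLp r).1) hpq
  have h2 : 0 = p.snd + q.snd := congrArg (fun r => (WithLp.ofLp r).2) hpq
  refine ⟨p.fst, (a : ℂ)⁻¹ • p.snd, ((a : ℂ) ^ 2)⁻¹ • (p.fst - f), (hmem p).1 hp, ?_, ?_⟩
  · refine hasWeakDeriv_iff.2 fun φ hφ hc _ v => ?_
    have hφG : WithLp.toLp 2 (testL2 hφ.continuous hc v,
        (a : ℂ) • testL2 (continuous_deriv_test hφ) hc.deriv v) ∈ G := by
      rw [hmem]
      change HasWeakDeriv ∅ (testL2 hφ.continuous hc v)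
        ((a : ℂ)⁻¹ • (a : ℂ) • testL2 (continuous_deriv_test hφ) hc.deriv v)
      rw [smul_smul, inv_mul_cancel₀ ha', one_smul]
      exact hasWeakDeriv_testL2 ∅ hφ hc v
    have h3 := (Submodule.mem_orthogonal _ _).1 hq _ hφG
    rw [WithLp.prod_inner_apply] at h3
    change ⟪testL2 hφ.continuous hc v, q.fst⟫
      + ⟪(a : ℂ) • testL2 (continuous_deriv_test hφ) hc.deriv v, q.snd⟫ = 0 at h3
    have h4 : p.fst - f = -q.fst := by rw [h1]; abel
    have h5 : p.snd = -q.snd := eq_neg_of_add_eq_zero_left h2.symm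
    rw [h4, h5]
    simp only [inner_smul_left, inner_smul_right, inner_neg_right, Complex.conj_ofReal] at h3 ⊢
    field_simp
    linear_combination -h3
  · rw [smul_smul, mul_inv_cancel₀ (pow_ne_zero 2 ha'), one_smul]
    abel

/-! ### Functions with prescribed jumps -/

omit [CompleteSpace V] in
theorem memLp_expStep {c : ℝ} (hc : 0 < c) (y : ℝ) (v : V) :
    MemLp (fun x => (Set.Ioi y).indicator (fun x => Real.exp (-c * (x - y))) x • v) 2
      (volume : Measure ℝ) := by
  have hm : AEStronglyMeasurable ((Set.Ioi y).indicator fun x => Real.exp (-c * (x - y)))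
      (volume : Measure ℝ) :=
    (Continuous.aestronglyMeasurable (by fun_prop)).indicator measurableSet_Ioi
  have h1 : MemLp ((Set.Ioi y).indicator fun x => Real.exp (-c * (x - y))) 2
      (volume : Measure ℝ) := by
    rw [memLp_two_iff_integrable_sq hm]
    have h2 : IntegrableOn (fun x => Real.exp (2 * c * y) * Real.exp (-(2 * c) * x))
        (Set.Ioi y) := (exp_neg_integrableOn_Ioi y (by linarith)).const_mul _
    refine ((integrable_indicator_iff measurableSet_Ioi).2 h2).congr
      (Eventually.of_forall fun x => ?_)
    by_cases hx : x ∈ Set.Ioi y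
    · simp only [Set.indicator_of_mem hx]
      rw [← Real.exp_add, ← Real.exp_nat_mul]
      congr 1
      push_cast
      ring
    · simp [Set.indicator_of_notMem hx]
  have h3 : MemLp (fun x => ‖v‖ * (Set.Ioi y).indicator (fun x => Real.exp (-c * (x - y))) x) 2
    (volume : Measure ℝ) := h1.const_mul _
  refine h3.of_le (hm.smul_const v) (Eventually.of_forall fun x => ?_)
  rw [norm_smul, norm_mul, norm_norm, mul_comm]

/-- The function that is `0` on the left of `y` and `e^{-c (x - y)} v` on the right. -/
def expStep {c : ℝ} (hc : 0 < c) (y : ℝ) (v : V) : L2 V := (memLp_expStep hc y v).toLp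

omit [CompleteSpace V] in
theorem coeFn_expStep {c : ℝ} (hc : 0 < c) (y : ℝ) (v : V) : expStep hc y v =ᵐ[volume]
    fun x => (Set.Ioi y).indicator (fun x => Real.exp (-c * (x - y))) x • v :=
  MemLp.coeFn_toLp _

theorem hasWeakDeriv_expStep {Y : Finset ℝ} {c : ℝ} (hc : 0 < c) {y : ℝ} (hy : y ∈ Y) (v : V) :
    HasWeakDeriv Y (expStep hc y v) ((-c : ℂ) • expStep hc y v) := by
  intro φ hφ hφc hd
  set e : ℝ → ℝ := fun x => Real.exp (-c * (x - y)) with he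
  have hed : ∀ x, HasDerivAt e (e x * -c) x := by
    intro x
    have h1 : HasDerivAt (fun x => -c * (x - y)) (-c) x := by
      simpa using ((hasDerivAt_id x).sub_const y).const_mul (-c)
    exact h1.exp
  have hec : ContDiff ℝ 1 e := by fun_prop
  have hφd : ∀ x, HasDerivAt φ (deriv φ x) x := fun x =>
    (hφ.differentiable (by simp) x).hasDerivAt
  have hφ0 : φ y = 0 := image_eq_zero_of_notMem_tsupport fun h => Set.disjoint_left.1 hd h hy
  have i1 : IntegrableOn (fun x => deriv φ x * e x) (Set.Ioi y) :=
    (((continuous_deriv_test hφ).mul hec.continuous).integrable_of_hasCompactSupport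
      hφc.deriv.mul_right).integrableOn
  have i2 : IntegrableOn (fun x => φ x * (e x * -c)) (Set.Ioi y) :=
    ((hφ.continuous.mul (hec.continuous.mul continuous_const)).integrable_of_hasCompactSupport
      hφc.mul_right).integrableOn
  have key : (∫ x in Set.Ioi y, deriv φ x * e x) = -∫ x in Set.Ioi y, φ x * (e x * -c) := by
    have h1 := HasCompactSupport.integral_Ioi_deriv_eq (f := fun x => φ x * e x)
      ((hφ.of_le (by simp)).mul hec) hφc.mul_right y
    have h2 : deriv (fun x => φ x * e x) = fun x => deriv φ x * e x + φ x * (e x * -c) :=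
      funext fun x => ((hφd x).mul (hed x)).deriv
    rw [h2, integral_add i1 i2, hφ0, zero_mul, neg_zero] at h1
    exact eq_neg_of_add_eq_zero_left h1
  have e1 : ∫ x, deriv φ x • (expStep hc y v : L2 V) x
      = (∫ x in Set.Ioi y, deriv φ x * e x) • v := by
    rw [← integral_smul_const, ← integral_indicator measurableSet_Ioi]
    refine integral_congr_ae ?_
    filter_upwards [coeFn_expStep hc y v] with x hx
    rw [hx]
    by_cases h : x ∈ Set.Ioi y <;> simp [Set.indicator, mul_smul, he]
  have e2 : ∫ x, φ x • ((-c : ℂ) • expStep hc y v : L2 V) x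
      = (∫ x in Set.Ioi y, φ x * (e x * -c)) • v := by
    rw [← integral_smul_const, ← integral_indicator measurableSet_Ioi]
    refine integral_congr_ae ?_
    filter_upwards [coeFn_expStep hc y v, Lp.coeFn_smul (-c : ℂ) (expStep hc y v)] with x hx hx'
    rw [hx', Pi.smul_apply, hx]
    have h3 : ∀ w : V, (-c : ℂ) • w = (-c : ℝ) • w := fun w => by
      rw [← Complex.coe_smul, Complex.ofReal_neg]
    rw [h3]
    by_cases h : x ∈ Set.Ioi y
    · simp only [Set.indicator_of_mem h, smul_smul]
      congr 1
      ring
    · simp [Set.indicator_of_notMem h]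
  rw [e1, e2, key, neg_smul]

omit [CompleteSpace V] in
theorem jump_expStep {c : ℝ} (hc : 0 < c) (y : ℝ) (v : V) (t : ℝ) :
    rightValue (expStep hc y v) t - leftValue (expStep hc y v) t = if t = y then v else 0 := by
  have hE : Continuous fun x => Real.exp (-c * (x - y)) • v := by fun_prop
  have h0 : Continuous fun _ : ℝ => (0 : V) := continuous_const
  have hr : ∀ b, ∀ᵐ x ∂volume, x ∈ Set.Ioo y b →
      expStep hc y v x = Real.exp (-c * (x - y)) • v := fun b => by
    filter_upwards [coeFn_expStep hc y v] with x hx h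
    rw [hx, Set.indicator_of_mem (show x ∈ Set.Ioi y from h.1)]
  have hl : ∀ a, ∀ᵐ x ∂volume, x ∈ Set.Ioo a y → expStep hc y v x = 0 := fun a => by
    filter_upwards [coeFn_expStep hc y v] with x hx h
    rw [hx, Set.indicator_of_notMem (show x ∉ Set.Ioi y from fun h' => lt_asymm h.2 h'), zero_smul]
  rcases lt_trichotomy t y with h | h | h
  · rw [rightValue_eq h0 (hl (t - 1)) ⟨by linarith, h⟩,
      leftValue_eq h0 (hl (t - 1)) ⟨by linarith, h.le⟩, if_neg h.ne, sub_self]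
  · subst h
    rw [rightValue_eq hE (hr (t + 1)) ⟨le_rfl, by linarith⟩,
      leftValue_eq h0 (hl (t - 1)) ⟨by linarith, le_rfl⟩]
    simp
  · rw [rightValue_eq hE (hr (t + 1)) ⟨h.le, by linarith⟩,
      leftValue_eq hE (hr (t + 1)) ⟨h, by linarith⟩, if_neg h.ne', sub_self]

/-! ### The jump maps -/

/-- The limit along a filter of almost everywhere sets, as a linear map. -/
def limMap (Y : Finset ℝ) (l : Filter ℝ) [l.NeBot] (hl : l ≤ ae volume)
    (h : ∀ f : H1 Y V, ∃ c, Tendsto (f : L2 V) l (𝓝 c)) : H1 Y V →ₗ[ℂ] V where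
  toFun f := limUnder l (f : L2 V)
  map_add' f g := Tendsto.limUnder_eq
    (((tendsto_nhds_limUnder (h f)).add (tendsto_nhds_limUnder (h g))).congr'
      (((Lp.coeFn_add (f : L2 V) (g : L2 V)).filter_mono hl).mono fun _ h => h.symm))
  map_smul' c f := Tendsto.limUnder_eq
    (((tendsto_nhds_limUnder (h f)).const_smul c).congr'
      (((Lp.coeFn_smul c (f : L2 V)).filter_mono hl).mono fun _ h => h.symm))

/-- The jump `f(y⁺) - f(y⁻)`. -/
def jumpValue (Y : Finset ℝ) (V : Type*) [NormedAddCommGroup V] [InnerProductSpace ℂ V]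
    [CompleteSpace V] (y : ℝ) : H1 Y V →ₗ[ℂ] V :=
  haveI := neBot_left y
  haveI := neBot_right y
  limMap Y (𝓝[>] y ⊓ ae volume) inf_le_right
      (fun f => exists_tendsto_right (hasWeakDeriv_weakDeriv f) y)
    - limMap Y (𝓝[<] y ⊓ ae volume) inf_le_right
      (fun f => exists_tendsto_left (hasWeakDeriv_weakDeriv f) y)

theorem jumpValue_apply {Y : Finset ℝ} (y : ℝ) (f : H1 Y V) :
    jumpValue Y V y f = rightValue (f : L2 V) y - leftValue (f : L2 V) y := rfl

theorem meanValue_apply {Y : Finset ℝ} (y : ℝ) (f : H1 Y V) : meanValue Y V y f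
    = (1 / 2 : ℂ) • (leftValue (f : L2 V) y + rightValue (f : L2 V) y) := rfl

/-- The product rule for jumps, in terms of jumps and mean values. -/
theorem innerJump_eq {Y : Finset ℝ} (f g : H1 Y V) (y : ℝ) :
    innerJump (f : L2 V) (g : L2 V) y = ⟪jumpValue Y V y f, meanValue Y V y g⟫
      + ⟪meanValue Y V y f, jumpValue Y V y g⟫ := by
  simp only [innerJump, jumpValue_apply, meanValue_apply, inner_smul_left, inner_smul_right,
    inner_add_left, inner_add_right, inner_sub_left, inner_sub_right, map_div₀, map_one, map_ofNat]
  ring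

theorem inner_weakDeriv_add {Y : Finset ℝ} (f g : H1 Y V) :
    ⟪weakDeriv Y V f, (g : L2 V)⟫ + ⟪(f : L2 V), weakDeriv Y V g⟫
      = -∑ y ∈ Y, (⟪jumpValue Y V y f, meanValue Y V y g⟫
        + ⟪meanValue Y V y f, jumpValue Y V y g⟫) := by
  rw [(hasWeakDeriv_weakDeriv f).inner_add_inner (hasWeakDeriv_weakDeriv g)]
  simp only [innerJump_eq]

theorem weakDeriv_eq {Y : Finset ℝ} {f g : L2 V} (h : HasWeakDeriv Y f g) (hf : f ∈ H1 Y V) :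
    weakDeriv Y V ⟨f, hf⟩ = g :=
  HasWeakDeriv.unique (hasWeakDeriv_weakDeriv ⟨f, hf⟩) h

theorem mem_H1_empty_iff {Y : Finset ℝ} (f : H1 Y V) :
    (f : L2 V) ∈ H1 ∅ V ↔ ∀ y ∈ Y, jumpValue Y V y f = 0 := by
  simp only [jumpValue_apply, sub_eq_zero]
  constructor
  · intro h y _
    obtain ⟨g, hg⟩ := mem_H1.1 h
    exact (hg.leftValue_eq_rightValue y).symm
  · intro h
    exact mem_H1.2 ⟨_, (hasWeakDeriv_weakDeriv f).of_jump_eq_zero fun y hy => (h y hy).symm⟩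

omit [CompleteSpace V] in
theorem H1_empty_le (Y : Finset ℝ) : H1 ∅ V ≤ H1 Y V := by
  intro f hf
  obtain ⟨g, hg⟩ := mem_H1.1 hf
  exact mem_H1.2 ⟨g, hg.mono⟩

theorem weakDeriv_empty_eq (Y : Finset ℝ) (f : H1 ∅ V) :
    weakDeriv Y V ⟨f, H1_empty_le Y f.2⟩ = weakDeriv ∅ V f :=
  weakDeriv_eq (hasWeakDeriv_weakDeriv f).mono _

theorem mem_H2 {Y : Finset ℝ} {f : L2 V} :
    f ∈ H2 Y V ↔ ∃ g k, HasWeakDeriv Y f g ∧ HasWeakDeriv Y g k := by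
  constructor
  · rintro ⟨u, hu, rfl⟩
    exact ⟨_, _, hasWeakDeriv_weakDeriv u, hasWeakDeriv_weakDeriv ⟨_, hu⟩⟩
  · rintro ⟨g, k, hg, hk⟩
    refine ⟨⟨f, mem_H1.2 ⟨g, hg⟩⟩, ?_, rfl⟩
    change weakDeriv Y V _ ∈ H1 Y V
    rw [weakDeriv_eq hg]
    exact mem_H1.2 ⟨k, hk⟩

end Sobolev

section Operators

/-! ### Bookkeeping for `ℂ²ⁿ` and the jump functions -/

/-- The vector of `ℂ²ⁿ` with components `x k : ℂ²`. -/
def collect {n : ℕ} (x : Fin n → C2) : C2n n := WithLp.toLp 2 fun p => x p.1 p.2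

theorem inner_collect {n : ℕ} (x w : Fin n → C2) :
    ⟪collect x, collect w⟫ = ∑ k, ⟪x k, w k⟫ := by
  simp only [PiLp.inner_apply, Fintype.sum_prod_type, collect]

section Steps

variable {V : Type*} [NormedAddCommGroup V] [InnerProductSpace ℂ V] [CompleteSpace V]
variable {n : ℕ} {y : Fin n → ℝ}

theorem mem_points (y : Fin n → ℝ) (k : Fin n) : y k ∈ points y :=
  Finset.mem_image_of_mem y (Finset.mem_univ k)

theorem sum_points (hy : Function.Injective y) (F : ℝ → ℂ) :
    ∑ t ∈ points y, F t = ∑ k, F (y k) :=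
  Finset.sum_image hy.injOn

theorem forall_mem_points {P : ℝ → Prop} : (∀ t ∈ points y, P t) ↔ ∀ k, P (y k) := by
  simp [points]

/-- `expStep` at the point `y k`, as an element of `H¹(ℝ ∖ Y)`. -/
def stepH1 {c : ℝ} (hc : 0 < c) (y : Fin n → ℝ) (k : Fin n) (v : V) : H1 (points y) V :=
  ⟨expStep hc (y k) v, mem_H1.2 ⟨_, hasWeakDeriv_expStep hc (mem_points y k) v⟩⟩

theorem weakDeriv_stepH1 {c : ℝ} (hc : 0 < c) (k : Fin n) (v : V) :
    weakDeriv (points y) V (stepH1 hc y k v) = (-c : ℂ) • (stepH1 hc y k v : L2 V) :=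
  weakDeriv_eq (hasWeakDeriv_expStep hc (mem_points y k) v) _

theorem jumpValue_stepH1 (hy : Function.Injective y) {c : ℝ} (hc : 0 < c) (j k : Fin n) (v : V) :
    jumpValue (points y) V (y j) (stepH1 hc y k v) = if j = k then v else 0 := by
  rw [jumpValue_apply]
  refine (jump_expStep hc (y k) v (y j)).trans ?_
  simp only [hy.eq_iff]

theorem jumpValue_sum_stepH1 (hy : Function.Injective y) {c : ℝ} (hc : 0 < c) (w : Fin n → V)
    (j : Fin n) :
    jumpValue (points y) V (y j) (∑ k, stepH1 hc y k (w k)) = w j := by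
  simp [jumpValue_stepH1 hy]

theorem weakDeriv_sum_stepH1 {c : ℝ} (hc : 0 < c) (w : Fin n → V) :
    weakDeriv (points y) V (∑ k, stepH1 hc y k (w k))
      = (((-c : ℂ) • ∑ k, stepH1 hc y k (w k) : H1 (points y) V) : L2 V) := by
  rw [map_sum, Submodule.coe_smul, AddSubmonoidClass.coe_finsetSum, Finset.smul_sum]
  exact Finset.sum_congr rfl fun k _ => weakDeriv_stepH1 hc k (w k)

end Steps

/-! ### Constant matrices on `L²(ℝ; ℂ²)` -/

section MatrixAct

variable (M N : Matrix (Fin 2) (Fin 2) ℂ)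

theorem coeFn_matrixAct (f : L2 C2) :
    matrixAct M f =ᵐ[volume] fun x => Matrix.toEuclideanCLM (𝕜 := ℂ) M (f x) :=
  ContinuousLinearMap.coeFn_compLpL _ f

theorem matrixAct_matrixAct (f : L2 C2) : matrixAct M (matrixAct N f) = matrixAct (M * N) f := by
  refine Lp.ext ?_
  filter_upwards [coeFn_matrixAct M (matrixAct N f), coeFn_matrixAct N f,
    coeFn_matrixAct (M * N) f] with x h1 h2 h3
  rw [h1, h2, h3, map_mul]
  rfl

theorem matrixAct_one (f : L2 C2) : matrixAct 1 f = f := by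
  refine Lp.ext ?_
  filter_upwards [coeFn_matrixAct 1 f] with x h1
  rw [h1, map_one]
  rfl

theorem matrixAct_neg (f : L2 C2) : matrixAct (-M) f = -matrixAct M f := by
  refine Lp.ext ?_
  filter_upwards [coeFn_matrixAct (-M) f, coeFn_matrixAct M f, Lp.coeFn_neg (matrixAct M f)]
    with x h1 h2 h3
  rw [h1, h3, Pi.neg_apply, h2, map_neg]
  rfl

theorem inner_toEuclideanCLM {M : Matrix (Fin 2) (Fin 2) ℂ} (hM : M.IsHermitian) (v w : C2) :
    ⟪Matrix.toEuclideanCLM (𝕜 := ℂ) M v, w⟫ = ⟪v, Matrix.toEuclideanCLM (𝕜 := ℂ) M w⟫ := by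
  have h : ContinuousLinearMap.adjoint (Matrix.toEuclideanCLM (𝕜 := ℂ) M)
      = Matrix.toEuclideanCLM (𝕜 := ℂ) M := by
    rw [← ContinuousLinearMap.star_eq_adjoint, ← map_star]
    exact congrArg _ hM
  rw [← ContinuousLinearMap.adjoint_inner_right, h]

theorem inner_matrixAct {M : Matrix (Fin 2) (Fin 2) ℂ} (hM : M.IsHermitian) (f g : L2 C2) :
    ⟪matrixAct M f, g⟫ = ⟪f, matrixAct M g⟫ := by
  rw [L2.inner_def, L2.inner_def]
  refine integral_congr_ae ?_
  filter_upwards [coeFn_matrixAct M f, coeFn_matrixAct M g] with x h1 h2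
  rw [h1, h2, inner_toEuclideanCLM hM]

variable {M}

theorem HasWeakDeriv.smul_add_smul {V : Type*} [NormedAddCommGroup V] [NormedSpace ℂ V]
    {Y : Finset ℝ} {f f' g g' : L2 V} (hf : HasWeakDeriv Y f f') (hg : HasWeakDeriv Y g g')
    (a c : ℂ) : HasWeakDeriv Y (a • f + c • g) (a • f' + c • g') :=
  (weakDerivGraph Y V).add_mem ((weakDerivGraph Y V).smul_mem a (x := (f, f')) hf)
    ((weakDerivGraph Y V).smul_mem c (x := (g, g')) hg)

theorem HasWeakDeriv.matrixAct {Y : Finset ℝ} {f g : L2 C2} (h : HasWeakDeriv Y f g) :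
    HasWeakDeriv Y (matrixAct M f) (matrixAct M g) := by
  have key : ∀ {φ : ℝ → ℝ} (_ : Continuous φ) (_ : HasCompactSupport φ) (f : L2 C2),
      ∫ x, φ x • (PointInteraction.matrixAct M f) x
        = Matrix.toEuclideanCLM (𝕜 := ℂ) M (∫ x, φ x • f x) := by
    intro φ hφ hc f
    rw [← ContinuousLinearMap.integral_comp_comm _
      (integrable_test_smul hφ hc (locallyIntegrable_L2 f))]
    refine integral_congr_ae ?_
    filter_upwards [coeFn_matrixAct M f] with x hx
    rw [hx, ← Complex.coe_smul, ← Complex.coe_smul, map_smul]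
  intro φ hφ hc hd
  rw [key (continuous_deriv_test hφ) hc.deriv, key hφ.continuous hc, h φ hφ hc hd, map_neg]

/-- The map `f ↦ M f` on `H¹(ℝ ∖ Y; ℂ²)`. -/
def matrixActH1 {Y : Finset ℝ} (M : Matrix (Fin 2) (Fin 2) ℂ) (f : H1 Y C2) : H1 Y C2 :=
  ⟨matrixAct M f, mem_H1.2 ⟨_, (hasWeakDeriv_weakDeriv f).matrixAct⟩⟩

variable {Y : Finset ℝ} (f : H1 Y C2) (y : ℝ)

theorem weakDeriv_matrixActH1 :
    weakDeriv Y C2 (matrixActH1 M f) = matrixAct M (weakDeriv Y C2 f) :=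
  weakDeriv_eq (hasWeakDeriv_weakDeriv f).matrixAct _

theorem leftValue_matrixAct : leftValue (matrixAct M (f : L2 C2)) y
    = Matrix.toEuclideanCLM (𝕜 := ℂ) M (leftValue (f : L2 C2) y) := by
  have := neBot_left y
  refine Tendsto.limUnder_eq ((((ContinuousLinearMap.continuous _).tendsto _).comp
    (tendsto_leftValue f y)).congr' (mem_inf_of_right ?_))
  filter_upwards [coeFn_matrixAct M (f : L2 C2)] with x hx using hx.symm

theorem rightValue_matrixAct : rightValue (matrixAct M (f : L2 C2)) y
    = Matrix.toEuclideanCLM (𝕜 := ℂ) M (rightValue (f : L2 C2) y) := by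
  have := neBot_right y
  refine Tendsto.limUnder_eq ((((ContinuousLinearMap.continuous _).tendsto _).comp
    (tendsto_rightValue f y)).congr' (mem_inf_of_right ?_))
  filter_upwards [coeFn_matrixAct M (f : L2 C2)] with x hx using hx.symm

theorem jumpValue_matrixActH1 : jumpValue Y C2 y (matrixActH1 M f)
    = Matrix.toEuclideanCLM (𝕜 := ℂ) M (jumpValue Y C2 y f) := by
  rw [jumpValue_apply, jumpValue_apply, map_sub, ← leftValue_matrixAct, ← rightValue_matrixAct]
  rfl

theorem meanValue_matrixActH1 : meanValue Y C2 y (matrixActH1 M f)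
    = Matrix.toEuclideanCLM (𝕜 := ℂ) M (meanValue Y C2 y f) := by
  rw [meanValue_apply, meanValue_apply, map_smul, map_add, ← leftValue_matrixAct,
    ← rightValue_matrixAct]
  rfl

end MatrixAct

/-! ### The Dirac operator -/

section Dirac

theorem isHermitian_sigma1 : (!![0, 1; 1, 0] : Matrix (Fin 2) (Fin 2) ℂ).IsHermitian := by
  ext i j
  fin_cases i <;> fin_cases j <;> simp

theorem isHermitian_sigma3 : (!![1, 0; 0, -1] : Matrix (Fin 2) (Fin 2) ℂ).IsHermitian := by
  ext i j
  fin_cases i <;> fin_cases j <;> simp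

theorem sigma1_mul_sigma1 : (!![0, 1; 1, 0] : Matrix (Fin 2) (Fin 2) ℂ) * !![0, 1; 1, 0] = 1 := by
  simp [Matrix.one_fin_two]

theorem sigma3_mul_sigma3 :
    (!![1, 0; 0, -1] : Matrix (Fin 2) (Fin 2) ℂ) * !![1, 0; 0, -1] = 1 := by
  simp [Matrix.one_fin_two]

theorem sigma3_mul_sigma1 : (!![1, 0; 0, -1] : Matrix (Fin 2) (Fin 2) ℂ) * !![0, 1; 1, 0]
    = -(!![0, 1; 1, 0] * !![1, 0; 0, -1]) := by
  simp

/-- The Dirac expression on `H¹(ℝ ∖ Y; ℂ²)`. -/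
def diracMax (Y : Finset ℝ) : H1 Y C2 →ₗ[ℂ] L2 C2 :=
  (-Complex.I) • ((matrixAct !![0, 1; 1, 0]).toLinearMap ∘ₗ weakDeriv Y C2)
    + (1 / 2 : ℂ) • ((matrixAct !![1, 0; 0, -1]).toLinearMap ∘ₗ (H1 Y C2).subtype)

theorem diracMax_apply {Y : Finset ℝ} (u : H1 Y C2) : diracMax Y u
    = (-Complex.I) • matrixAct !![0, 1; 1, 0] (weakDeriv Y C2 u)
      + (1 / 2 : ℂ) • matrixAct !![1, 0; 0, -1] (u : L2 C2) := rfl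

/-- The map `i σ₁` on `ℂ²`. -/
def jumpMatrix : C2 →L[ℂ] C2 :=
  Complex.I • Matrix.toEuclideanCLM (𝕜 := ℂ) (!![0, 1; 1, 0] : Matrix (Fin 2) (Fin 2) ℂ)

theorem jumpMatrix_jumpMatrix (v : C2) : jumpMatrix (jumpMatrix v) = -v := by
  have h : Matrix.toEuclideanCLM (𝕜 := ℂ) (!![0, 1; 1, 0] : Matrix (Fin 2) (Fin 2) ℂ)
      (Matrix.toEuclideanCLM (𝕜 := ℂ) (!![0, 1; 1, 0] : Matrix (Fin 2) (Fin 2) ℂ) v) = v := by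
    rw [← mul_apply_eq_comp, ← map_mul, sigma1_mul_sigma1, map_one,
      one_apply_eq_self]
  simp only [jumpMatrix, smul_apply, map_smul, smul_smul, Complex.I_mul_I, h,
    neg_smul, one_smul]

variable {n : ℕ} (y : Fin n → ℝ)

/-- The jump trace `(i σ₁ [Ψ]_{y_1}, …, i σ₁ [Ψ]_{y_n})`. -/
def jumpDirac : H1 (points y) C2 →ₗ[ℂ] C2n n :=
  (WithLp.linearEquiv 2 ℂ (Fin n × Fin 2 → ℂ)).symm.toLinearMap ∘ₗ
    LinearMap.pi fun p => (EuclideanSpace.proj (𝕜 := ℂ) p.2).toLinearMap ∘ₗ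
      jumpMatrix.toLinearMap ∘ₗ jumpValue (points y) C2 (y p.1)

theorem jumpDirac_apply (u : H1 (points y) C2) :
    jumpDirac y u = collect fun k => jumpMatrix (jumpValue (points y) C2 (y k) u) := rfl

/-- The trace `τ`, as a linear map on `H¹(ℝ ∖ Y; ℂ²)`. -/
def meanDirac : H1 (points y) C2 →ₗ[ℂ] C2n n := (traceDirac y).toFun

theorem meanDirac_apply (u : H1 (points y) C2) :
    meanDirac y u = collect fun k => meanValue (points y) C2 (y k) u := rfl

theorem green_dirac {y : Fin n → ℝ} (hy : Function.Injective y) (u v : H1 (points y) C2) :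
    ⟪diracMax (points y) u, (v : L2 C2)⟫ - ⟪(u : L2 C2), diracMax (points y) v⟫
      = ⟪jumpDirac y u, meanDirac y v⟫ - ⟪meanDirac y u, jumpDirac y v⟫ := by
  have hG := inner_weakDeriv_add u (matrixActH1 !![0, 1; 1, 0] v)
  rw [weakDeriv_matrixActH1, sum_points hy] at hG
  simp only [jumpValue_matrixActH1, meanValue_matrixActH1] at hG
  have e : ((matrixActH1 !![0, 1; 1, 0] v : H1 (points y) C2) : L2 C2)
      = matrixAct !![0, 1; 1, 0] (v : L2 C2) := rfl
  rw [e] at hG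
  rw [diracMax_apply, diracMax_apply, jumpDirac_apply, jumpDirac_apply, meanDirac_apply,
    meanDirac_apply, inner_collect, inner_collect, ← Finset.sum_sub_distrib]
  simp only [jumpMatrix, smul_apply, inner_smul_left, inner_smul_right,
    inner_add_left, inner_add_right, inner_matrixAct isHermitian_sigma1,
    inner_matrixAct isHermitian_sigma3, inner_toEuclideanCLM isHermitian_sigma1]
  have h2 : (starRingEnd ℂ) (1 / 2 : ℂ) = 1 / 2 := by
    rw [map_div₀, map_one, map_ofNat]
  rw [h2, map_neg, Complex.conj_I]
  have h3 : ∀ k, (-Complex.I * ⟪jumpValue (points y) C2 (y k) u,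
        Matrix.toEuclideanCLM (𝕜 := ℂ) !![0, 1; 1, 0] (meanValue (points y) C2 (y k) v)⟫
      - Complex.I * ⟪meanValue (points y) C2 (y k) u,
        Matrix.toEuclideanCLM (𝕜 := ℂ) !![0, 1; 1, 0] (jumpValue (points y) C2 (y k) v)⟫)
      = -Complex.I * (⟪jumpValue (points y) C2 (y k) u,
        Matrix.toEuclideanCLM (𝕜 := ℂ) !![0, 1; 1, 0] (meanValue (points y) C2 (y k) v)⟫
      + ⟪meanValue (points y) C2 (y k) u,
        Matrix.toEuclideanCLM (𝕜 := ℂ) !![0, 1; 1, 0] (jumpValue (points y) C2 (y k) v)⟫) :=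
    fun k => by ring
  rw [Finset.sum_congr rfl fun k _ => h3 k, ← Finset.mul_sum]
  linear_combination Complex.I * hG

/-- The free Dirac operator is onto: `D² = -d²/dx² + 1/4`, so that `Ψ = D u` solves `D Ψ = f` when
`-u'' + u / 4 = f`. -/
theorem exists_diracMax_eq (f : L2 C2) : ∃ Ψ : H1 ∅ C2, diracMax ∅ Ψ = f := by
  -- `-4 u'' + u = 4 f` is the equation `-u'' + u / 4 = f`
  obtain ⟨u, u', u'', h1, h2, h3⟩ := exists_second_order 2 two_ne_zero ((4 : ℂ) • f)
  have hΨ := (h2.matrixAct (M := !![0, 1; 1, 0])).smul_add_smul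
    (h1.matrixAct (M := !![1, 0; 0, -1])) (-Complex.I) (1 / 2)
  refine ⟨⟨_, mem_H1.2 ⟨_, hΨ⟩⟩, ?_⟩
  rw [diracMax_apply, weakDeriv_eq hΨ]
  dsimp only
  simp only [map_add, map_smul, matrixAct_matrixAct, sigma1_mul_sigma1, sigma3_mul_sigma3,
    sigma3_mul_sigma1, matrixAct_one, matrixAct_neg, smul_add, smul_smul, smul_neg]
  have h4 : f = (1 / 4 : ℂ) • (-(((2 : ℝ) : ℂ) ^ 2 • u'') + u) := by
    rw [h3, smul_smul, show (1 / 4 : ℂ) * 4 = 1 by norm_num, one_smul]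
  rw [h4, smul_add, smul_neg, smul_smul]
  have e1 : (-Complex.I * -Complex.I) = -1 := by rw [neg_mul_neg, Complex.I_mul_I]
  have e2 : (1 / 4 : ℂ) * ((2 : ℝ) : ℂ) ^ 2 = 1 := by norm_num
  have e3 : (1 / 2 : ℂ) * (1 / 2) = 1 / 4 := by norm_num
  rw [e1, e2, e3, mul_comm (1 / 2 : ℂ) (-Complex.I), neg_smul, one_smul]
  abel

theorem jumpDirac_surjective {y : Fin n → ℝ} (hy : Function.Injective y) :
    Function.Surjective (jumpDirac y) := by
  intro ξ
  refine ⟨∑ k, stepH1 one_pos y k (-jumpMatrix (WithLp.toLp 2 fun j => ξ (k, j))), ?_⟩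
  rw [jumpDirac_apply]
  simp only [jumpValue_sum_stepH1 hy, map_neg, jumpMatrix_jumpMatrix, neg_neg]
  rfl

theorem mem_H1_empty_iff_jumpDirac (u : H1 (points y) C2) :
    (u : L2 C2) ∈ H1 ∅ C2 ↔ jumpDirac y u = 0 := by
  rw [mem_H1_empty_iff, forall_mem_points, jumpDirac_apply]
  constructor
  · intro h
    simp only [h, map_zero]
    rfl
  · intro h k
    have h1 : jumpMatrix (jumpValue (points y) C2 (y k) u) = 0 := by
      ext j
      exact congrArg (fun ξ : C2n n => ξ (k, j)) h
    have h2 := jumpMatrix_jumpMatrix (jumpValue (points y) C2 (y k) u)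
    rw [h1, map_zero] at h2
    exact neg_eq_zero.1 h2.symm

theorem diracMax_empty_eq (Y : Finset ℝ) (u : H1 ∅ C2) :
    diracMax ∅ u = diracMax Y ⟨u, H1_empty_le Y u.2⟩ := by
  rw [diracMax_apply, diracMax_apply, weakDeriv_empty_eq Y u]

/-- The boundary triple of the Dirac operator. -/
def diracTriple {y : Fin n → ℝ} (hy : Function.Injective y) :
    BoundaryTriple freeDirac (traceDirac y) where
  maxOp := diracMax (points y)
  jump := jumpDirac y
  green := green_dirac hy
  jump_surjective := jumpDirac_surjective hy
  domain_le := H1_empty_le _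
  mem_domain_iff := mem_H1_empty_iff_jumpDirac y
  apply_eq := diracMax_empty_eq (points y)
  basePoint := 0
  surjective_base f := by
    obtain ⟨Ψ, hΨ⟩ := exists_diracMax_eq (-f)
    have h : freeDirac Ψ = -f := hΨ
    exact ⟨Ψ, by rw [h]; simp⟩

end Dirac

/-! ### The Schrödinger operator -/

section Schr

theorem H2_empty_le (Y : Finset ℝ) : H2 ∅ ℂ ≤ H2 Y ℂ := by
  intro f hf
  obtain ⟨g, k, hg, hk⟩ := mem_H2.1 hf
  exact mem_H2.2 ⟨g, k, hg.mono, hk.mono⟩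

/-- The inclusion of `H²(ℝ ∖ Y)` in `H¹(ℝ ∖ Y)`. -/
def inclH1 {Y : Finset ℝ} (u : H2 Y ℂ) : H1 Y ℂ := Submodule.inclusion (H2_le_H1 Y ℂ) u

theorem coe_weakDerivH2 {Y : Finset ℝ} (u : H2 Y ℂ) :
    (weakDerivH2 Y ℂ u : L2 ℂ) = weakDeriv Y ℂ (inclH1 u) := rfl

theorem mem_H2_empty_iff {Y : Finset ℝ} (u : H2 Y ℂ) :
    (u : L2 ℂ) ∈ H2 ∅ ℂ ↔ ∀ t ∈ Y, jumpValue Y ℂ t (inclH1 u) = 0 ∧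
      jumpValue Y ℂ t (weakDerivH2 Y ℂ u) = 0 := by
  have h1 := mem_H1_empty_iff (inclH1 u)
  have h2 := mem_H1_empty_iff (weakDerivH2 Y ℂ u)
  rw [forall₂_and, ← h1, ← h2]
  constructor
  · intro h
    obtain ⟨g, k, hg, hk⟩ := mem_H2.1 h
    refine ⟨H2_le_H1 _ _ h, ?_⟩
    rw [coe_weakDerivH2]
    have : weakDeriv Y ℂ (inclH1 u) = g := weakDeriv_eq hg.mono _
    rw [this]
    exact mem_H1.2 ⟨k, hk⟩
  · rintro ⟨h3, h4⟩
    obtain ⟨g, hg⟩ := mem_H1.1 h3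
    obtain ⟨k, hk⟩ := mem_H1.1 h4
    have : weakDeriv Y ℂ (inclH1 u) = g := weakDeriv_eq hg.mono _
    rw [coe_weakDerivH2, this] at hk
    exact mem_H2.2 ⟨g, k, hg, hk⟩

variable {n : ℕ} (y : Fin n → ℝ)

/-- The expression `-ψ''` on `H²(ℝ ∖ Y)`. -/
def schrMax (Y : Finset ℝ) : H2 Y ℂ →ₗ[ℂ] L2 ℂ := -(weakDeriv Y ℂ ∘ₗ weakDerivH2 Y ℂ)

theorem schrMax_apply {Y : Finset ℝ} (u : H2 Y ℂ) :
    schrMax Y u = -weakDeriv Y ℂ (weakDerivH2 Y ℂ u) := rfl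

theorem schrMax_eq {Y : Finset ℝ} {f g k : L2 ℂ} (hg : HasWeakDeriv Y f g)
    (hk : HasWeakDeriv Y g k) (hf : f ∈ H2 Y ℂ) : schrMax Y ⟨f, hf⟩ = -k := by
  have h1 : (weakDerivH2 Y ℂ ⟨f, hf⟩ : L2 ℂ) = g := weakDeriv_eq hg _
  rw [schrMax_apply]
  congr 1
  refine HasWeakDeriv.unique (hasWeakDeriv_weakDeriv _) ?_
  rwa [h1]

/-- The jump trace `([ψ']_{y_1} ⊕ -[ψ]_{y_1}, …, [ψ']_{y_n} ⊕ -[ψ]_{y_n})`. -/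
def jumpSchr : H2 (points y) ℂ →ₗ[ℂ] C2n n :=
  (WithLp.linearEquiv 2 ℂ (Fin n × Fin 2 → ℂ)).symm.toLinearMap ∘ₗ
    LinearMap.pi fun p =>
      ![jumpValue (points y) ℂ (y p.1) ∘ₗ weakDerivH2 (points y) ℂ,
        -(jumpValue (points y) ℂ (y p.1) ∘ₗ Submodule.inclusion (H2_le_H1 (points y) ℂ))] p.2

theorem jumpSchr_apply (u : H2 (points y) ℂ) :
    jumpSchr y u = collect fun k => !₂[jumpValue (points y) ℂ (y k) (weakDerivH2 (points y) ℂ u),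
      -jumpValue (points y) ℂ (y k) (inclH1 u)] := by
  ext ⟨k, j⟩
  fin_cases j <;> rfl

/-- The trace `τ̂`, as a linear map on `H²(ℝ ∖ Y)`. -/
def meanSchr : H2 (points y) ℂ →ₗ[ℂ] C2n n := (traceSchr y).toFun

theorem meanSchr_apply (u : H2 (points y) ℂ) :
    meanSchr y u = collect fun k => !₂[meanValue (points y) ℂ (y k) (inclH1 u),
      meanValue (points y) ℂ (y k) (weakDerivH2 (points y) ℂ u)] := by
  ext ⟨k, j⟩
  fin_cases j <;> rfl

theorem green_schr {y : Fin n → ℝ} (hy : Function.Injective y) (u v : H2 (points y) ℂ) :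
    ⟪schrMax (points y) u, (v : L2 ℂ)⟫ - ⟪(u : L2 ℂ), schrMax (points y) v⟫
      = ⟪jumpSchr y u, meanSchr y v⟫ - ⟪meanSchr y u, jumpSchr y v⟫ := by
  have hG1 := inner_weakDeriv_add (weakDerivH2 (points y) ℂ u) (inclH1 v)
  have hG2 := inner_weakDeriv_add (inclH1 u) (weakDerivH2 (points y) ℂ v)
  rw [sum_points hy, coe_weakDerivH2] at hG1
  rw [sum_points hy, coe_weakDerivH2] at hG2
  have e1 : ((inclH1 u : H1 (points y) ℂ) : L2 ℂ) = u := rfl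
  have e2 : ((inclH1 v : H1 (points y) ℂ) : L2 ℂ) = v := rfl
  rw [e2] at hG1
  rw [e1] at hG2
  rw [schrMax_apply, schrMax_apply, jumpSchr_apply, jumpSchr_apply, meanSchr_apply,
    meanSchr_apply, inner_collect, inner_collect, ← Finset.sum_sub_distrib, inner_neg_left,
    inner_neg_right]
  have h3 : ∀ a b c d : ℂ, ⟪(!₂[a, b] : C2), !₂[c, d]⟫ = ⟪a, c⟫ + ⟪b, d⟫ := by
    intro a b c d
    simp [PiLp.inner_apply]
  simp only [h3, inner_neg_left, inner_neg_right]
  have h4 : -⟪weakDeriv (points y) ℂ (weakDerivH2 (points y) ℂ u), (v : L2 ℂ)⟫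
      - -⟪(u : L2 ℂ), weakDeriv (points y) ℂ (weakDerivH2 (points y) ℂ v)⟫
      = -(-∑ k, (⟪jumpValue (points y) ℂ (y k) (weakDerivH2 (points y) ℂ u),
          meanValue (points y) ℂ (y k) (inclH1 v)⟫
        + ⟪meanValue (points y) ℂ (y k) (weakDerivH2 (points y) ℂ u),
          jumpValue (points y) ℂ (y k) (inclH1 v)⟫))
        + -∑ k, (⟪jumpValue (points y) ℂ (y k) (inclH1 u),
          meanValue (points y) ℂ (y k) (weakDerivH2 (points y) ℂ v)⟫
        + ⟪meanValue (points y) ℂ (y k) (inclH1 u),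
          jumpValue (points y) ℂ (y k) (weakDerivH2 (points y) ℂ v)⟫) := by
    linear_combination -hG1 + hG2
  rw [h4, neg_neg, ← sub_eq_add_neg, ← Finset.sum_sub_distrib]
  exact Finset.sum_congr rfl fun k _ => by ring

/-- Two exponential steps per point, with rates `1` and `2`, produce arbitrary jumps of `ψ` and
`ψ'`. -/
theorem exists_jumpSchr_eq {y : Fin n → ℝ} (hy : Function.Injective y) (ξ : C2n n) :
    ∃ u, jumpSchr y u = ξ := by
  -- the jumps `α + β` of `ψ` and `-α - 2 β` of `ψ'` are to be `-ξ (k, 1)` and `ξ (k, 0)`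
  set α : Fin n → ℂ := fun k => ξ (k, 0) - 2 * ξ (k, 1) with hα
  set β : Fin n → ℂ := fun k => ξ (k, 1) - ξ (k, 0) with hβ
  set p : H1 (points y) ℂ := ∑ k, stepH1 one_pos y k (α k) with hp
  set q : H1 (points y) ℂ := ∑ k, stepH1 two_pos y k (β k) with hq
  set f : H1 (points y) ℂ := p + q with hf
  set g : H1 (points y) ℂ := (-(1 : ℝ) : ℂ) • p + (-(2 : ℝ) : ℂ) • q with hg
  have hfg : weakDeriv (points y) ℂ f = g := by
    rw [hf, map_add, hp, hq, weakDeriv_sum_stepH1, weakDeriv_sum_stepH1]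
    rfl
  have hfm : (f : L2 ℂ) ∈ H2 (points y) ℂ := by
    refine mem_H2.2 ⟨g, _, ?_, hasWeakDeriv_weakDeriv g⟩
    rw [← hfg]
    exact hasWeakDeriv_weakDeriv f
  have e1 : inclH1 ⟨f, hfm⟩ = f := rfl
  have e2 : weakDerivH2 (points y) ℂ ⟨f, hfm⟩ = g := Subtype.ext hfg
  refine ⟨⟨f, hfm⟩, ?_⟩
  rw [jumpSchr_apply, e1, e2]
  ext ⟨k, j⟩
  simp only [hf, hg, hp, hq, map_add, map_smul, jumpValue_sum_stepH1 hy, hα, hβ, collect]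
  fin_cases j
  · simp
    ring
  · simp
    ring

theorem mem_H2_empty_iff_jumpSchr (u : H2 (points y) ℂ) :
    (u : L2 ℂ) ∈ H2 ∅ ℂ ↔ jumpSchr y u = 0 := by
  rw [mem_H2_empty_iff, forall_mem_points, jumpSchr_apply]
  constructor
  · intro h
    ext ⟨k, j⟩
    obtain ⟨h1, h2⟩ := h k
    fin_cases j
    · exact h2
    · exact neg_eq_zero.2 h1
  · intro h k
    exact ⟨neg_eq_zero.1 (congrArg (fun ξ : C2n n => ξ (k, 1)) h),
      congrArg (fun ξ : C2n n => ξ (k, 0)) h⟩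

theorem schrMax_empty_eq (Y : Finset ℝ) (u : H2 ∅ ℂ) :
    schrMax ∅ u = schrMax Y ⟨u, H2_empty_le Y u.2⟩ := by
  obtain ⟨g, k, hg, hk⟩ := mem_H2.1 u.2
  exact (schrMax_eq hg hk u.2).trans (schrMax_eq hg.mono hk.mono _).symm

/-- The boundary triple of the Schrödinger operator. -/
def schrTriple {y : Fin n → ℝ} (hy : Function.Injective y) :
    BoundaryTriple freeSchr (traceSchr y) where
  maxOp := schrMax (points y)
  jump := jumpSchr y
  green := green_schr hy
  jump_surjective := exists_jumpSchr_eq hy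
  domain_le := H2_empty_le _
  mem_domain_iff := mem_H2_empty_iff_jumpSchr y
  apply_eq := schrMax_empty_eq (points y)
  basePoint := -1
  surjective_base f := by
    obtain ⟨u, u', u'', h1, h2, h3⟩ := exists_second_order 1 one_ne_zero (-f)
    have hu : u ∈ H2 ∅ ℂ := mem_H2.2 ⟨u', u'', h1, h2⟩
    have h : freeSchr ⟨u, hu⟩ = -u'' := schrMax_eq h1 h2 hu
    refine ⟨⟨u, hu⟩, ?_⟩
    rw [h, ← neg_eq_iff_eq_neg.2 h3]
    simp [add_comm]

end Schr

end Operators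

end
end PointInteraction

theorem theorem2p1 (n : ℕ) (y : Fin n → ℝ) (hy : StrictMono y) :
    -- the Dirac operator
    ((∀ z ∈ resSet freeDirac, IsComp (traceDirac y) (res freeDirac z) (comp (traceDirac y) (res freeDirac z)) ∧
        IsComp (traceDirac y) (gField freeDirac (traceDirac y) z)
          (comp (traceDirac y) (gField freeDirac (traceDirac y) z))) ∧
      ∃ ext : ExtParam (C2n n) ≃ SelfAdjointExt (restrictKer freeDirac (traceDirac y)),
        ∀ p : ExtParam (C2n n),
          -- the resolvent formula
          (∀ z ∈ resSet (ext p).1 ∩ resSet freeDirac,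
            IsUnit (kreinGamma freeDirac (traceDirac y) p z) ∧
            ∀ f : L2 C2, res (ext p).1 z f = res freeDirac z f +
              gField freeDirac (traceDirac y) z (Ring.inverse (kreinGamma freeDirac (traceDirac y) p z)
                (p.proj.rangeRestrict (ContinuousLinearMap.adjoint
                  (gField freeDirac (traceDirac y) (starRingEnd ℂ z)) f)))) ∧
          -- the domain
          (∀ z ∈ resSet freeDirac, ∀ Ψ : L2 C2, Ψ ∈ (ext p).1.domain ↔
            ∃ Ψz ∈ H1 ∅ C2, ∃ ξ : p.proj.range,
              Ψ = Ψz + gField freeDirac (traceDirac y) z ξ ∧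
              ∃ h : Ψ ∈ H1 (points y) C2,
                p.proj.rangeRestrict (traceDirac y ⟨Ψ, h⟩) = p.op ξ) ∧
          -- the action
          (∀ z ∈ resSet freeDirac, ∀ (Ψ : (ext p).1.domain) (Ψz : freeDirac.domain)
            (ξ : p.proj.range), (Ψ : L2 C2) = Ψz + gField freeDirac (traceDirac y) z ξ →
              -(ext p).1 Ψ + z • (Ψ : L2 C2) = -freeDirac Ψz + z • (Ψz : L2 C2)) ∧
          -- uniqueness of the decomposition, with `ξ` independent of `z`
          (∀ Ψ ∈ (ext p).1.domain, ∃ ξ : p.proj.range, ∀ z ∈ resSet freeDirac,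
            Ψ - gField freeDirac (traceDirac y) z ξ ∈ H1 ∅ C2 ∧
            ∀ Ψz ∈ H1 ∅ C2, ∀ η : p.proj.range,
              Ψ = Ψz + gField freeDirac (traceDirac y) z η →
                η = ξ ∧ Ψz = Ψ - gField freeDirac (traceDirac y) z ξ)) ∧
    -- the Schrödinger operator
    ((∀ z ∈ resSet freeSchr, IsComp (traceSchr y) (res freeSchr z) (comp (traceSchr y) (res freeSchr z)) ∧
        IsComp (traceSchr y) (gField freeSchr (traceSchr y) z)
          (comp (traceSchr y) (gField freeSchr (traceSchr y) z))) ∧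
      ∃ ext : ExtParam (C2n n) ≃ SelfAdjointExt (restrictKer freeSchr (traceSchr y)),
        ∀ p : ExtParam (C2n n),
          -- the resolvent formula
          (∀ z ∈ resSet (ext p).1 ∩ resSet freeSchr,
            IsUnit (kreinGamma freeSchr (traceSchr y) p z) ∧
            ∀ f : L2 ℂ, res (ext p).1 z f = res freeSchr z f +
              gField freeSchr (traceSchr y) z (Ring.inverse (kreinGamma freeSchr (traceSchr y) p z)
                (p.proj.rangeRestrict (ContinuousLinearMap.adjoint
                  (gField freeSchr (traceSchr y) (starRingEnd ℂ z)) f)))) ∧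
          -- the domain
          (∀ z ∈ resSet freeSchr, ∀ ψ : L2 ℂ, ψ ∈ (ext p).1.domain ↔
            ∃ ψz ∈ H2 ∅ ℂ, ∃ ξ : p.proj.range,
              ψ = ψz + gField freeSchr (traceSchr y) z ξ ∧
              ∃ h : ψ ∈ H2 (points y) ℂ,
                p.proj.rangeRestrict (traceSchr y ⟨ψ, h⟩) = p.op ξ) ∧
          -- the action
          (∀ z ∈ resSet freeSchr, ∀ (ψ : (ext p).1.domain) (ψz : freeSchr.domain)
            (ξ : p.proj.range), (ψ : L2 ℂ) = ψz + gField freeSchr (traceSchr y) z ξ →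
              -(ext p).1 ψ + z • (ψ : L2 ℂ) = -freeSchr ψz + z • (ψz : L2 ℂ)) ∧
          -- uniqueness of the decomposition, with `ξ` independent of `z`
          (∀ ψ ∈ (ext p).1.domain, ∃ ξ : p.proj.range, ∀ z ∈ resSet freeSchr,
            ψ - gField freeSchr (traceSchr y) z ξ ∈ H2 ∅ ℂ ∧
            ∀ ψz ∈ H2 ∅ ℂ, ∀ η : p.proj.range,
              ψ = ψz + gField freeSchr (traceSchr y) z η →
                η = ξ ∧ ψz = ψ - gField freeSchr (traceSchr y) z ξ)) := by
  constructor
  · let b := diracTriple hy.injective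
    exact ⟨fun z hz => ⟨b.isComp_res hz, b.isComp_gField hz⟩, b.extEquiv, fun p =>
      ⟨fun z hz => ⟨b.isUnit_kreinGamma p hz.1 hz.2, b.res_extEquiv p hz.1 hz.2⟩,
        fun z hz => b.mem_extEquiv_iff p hz,
        fun z hz Ψ Ψz ξ e => b.extEquiv_apply_of_eq_add p hz Ψ Ψz ξ e,
        b.exists_unique_decomposition p⟩⟩
  · let b := schrTriple hy.injective
    exact ⟨fun z hz => ⟨b.isComp_res hz, b.isComp_gField hz⟩, b.extEquiv, fun p =>
      ⟨fun z hz => ⟨b.isUnit_kreinGamma p hz.1 hz.2, b.res_extEquiv p hz.1 hz.2⟩,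
        fun z hz => b.mem_extEquiv_iff p hz,
        fun z hz ψ ψz ξ e => b.extEquiv_apply_of_eq_add p hz ψ ψz ξ e,
        b.exists_unique_decomposition p⟩⟩
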